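/- Let $\mathcal X_1,\mathcal X_2,\mathcal Z$ be finite alphabets, let $W_{Z|X_1X_2}$ be a transition probability from $\mathcal X_1\times\mathcal X_2$ to $\mathcal Z$ (a discrete memoryless multiple-access channel), and let $Q_Z$ be a probability distribution on $\mathcal Z$. For rates $R_1,R_2\ge 0$, a $(2^{nR_1},2^{nR_2},n)$ code with degraded message sets consists of encoding functions $f_{1i}:\mathcal M_1\to\mathcal X_1$ and $f_{2i}:\mathcal M_1\times\mathcal M_2\to\mathcal X_2$, $1\le i\le n$, where $\mathcal M_k=\{1,\dots,\lfloor 2^{nR_k}\rfloor\}$ for $k=1,2$. It induces the output distribution $$P_{Z^n}(z^n)=\frac1{|\mathcal M_1||\mathcal M_2|}\sum_{m_1\in\mathcal M_1}\sum_{m_2\in\mathcal M_2}\prod_{i=1}^n W\big(z_i\,\big|\,f_{1i}(m_1),f_{2i}(m_1,m_2)\big),$$ i.e. the messages are independent and uniform. Call $(R_1,R_2)$, $R_1,R_2\ge 0$, achievable if there is a sequence of $(2^{nR_1},2^{nR_2},n)$ codes with $\lim_{n\to\infty}\mathbb D(P_{Z^n}\|Q_Z^{\otimes n})=0$, where $\mathbb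 D(P\|Q)=\sum_x P(x)\log_2\frac{P(x)}{Q(x)}\in[0,+\infty]$ is the (unnormalized) Kullback–Leibler divergence. The resolvability region is the closure in $\mathbb R^2$ of the set of achievable pairs. Theorem. The resolvability region is exactly the set of pairs $(R_1,R_2)$ with $R_1,R_2\ge 0$ for which there is a probability distribution $P_{X_1X_2}$ on $\mathcal X_1\times\mathcal X_2$ such that, under the joint distribution $P_{X_1X_2}W_{Z|X_1X_2}$, the marginal distribution of $Z$ is $Q_Z$ and $$R_1\ge I(X_1;Z),\qquad R_1+R_2\ge I(X_1,X_2;Z),$$ where mutual information is measured in bits. -/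

import Mathlib

open scoped BigOperators

noncomputable section

namespace MACResolvability

/-- Relative entropy `D(P‖Q) = ∑ₐ P(a) log₂ (P(a) / Q(a))` (in bits) of two probability vectors on
a finite alphabet, as an extended real: it is `+∞` as soon as some letter has `P(a) ≠ 0` and
`Q(a) = 0`, and letters with `P(a) = 0` contribute `0`. -/
def relEntropy {α : Type*} [Fintype α] (P Q : α → ℝ) : EReal :=
  open Classical in
  if ∃ a, P a ≠ 0 ∧ Q a = 0 then ⊤
  else ((∑ a, P a * Real.logb 2 (P a / Q a) : ℝ) : EReal)

/-- Mutual information `I(A;B)` in bits, for a pair `(A, B)` with joint law `P` on `α × β`.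
A pair of letters with `P(a, b) = 0` contributes `0`; if `P(a, b) > 0` then both marginals are
positive there. -/
def mutualInfo {α β : Type*} [Fintype α] [Fintype β] (P : α × β → ℝ) : ℝ :=
  ∑ a, ∑ b, P (a, b) * Real.logb 2 (P (a, b) / ((∑ b', P (a, b')) * ∑ a', P (a', b)))

/-- The product law `Q^{⊗n}(zⁿ) = ∏ᵢ Q(zᵢ)`. -/
def iidLaw {α : Type*} (Q : α → ℝ) (n : ℕ) : (Fin n → α) → ℝ :=
  fun z => ∏ i, Q (z i)

variable {X₁ X₂ Z : Type*}

/-- `W` is a transition probability from `X₁ × X₂` to `Z`; `W x₁ x₂ z` is `W(z | x₁, x₂)`. -/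
def IsChannel [Fintype Z] (W : X₁ → X₂ → Z → ℝ) : Prop :=
  ∀ x₁ x₂, W x₁ x₂ ∈ stdSimplex ℝ Z

/-- The law of `((X₁, X₂), Z)` under `P_{X₁X₂} W_{Z|X₁X₂}`. -/
def lawInputsOutput (P : X₁ × X₂ → ℝ) (W : X₁ → X₂ → Z → ℝ) : (X₁ × X₂) × Z → ℝ :=
  fun p => P p.1 * W p.1.1 p.1.2 p.2

/-- The marginal law of `(X₁, Z)` under `P_{X₁X₂} W_{Z|X₁X₂}`. -/
def lawFirstOutput [Fintype X₂] (P : X₁ × X₂ → ℝ) (W : X₁ → X₂ → Z → ℝ) : X₁ × Z → ℝ :=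
  fun p => ∑ x₂, lawInputsOutput P W ((p.1, x₂), p.2)

/-- The marginal law of `Z` under `P_{X₁X₂} W_{Z|X₁X₂}`. -/
def lawOutput [Fintype X₁] [Fintype X₂] (P : X₁ × X₂ → ℝ) (W : X₁ → X₂ → Z → ℝ) : Z → ℝ :=
  fun z => ∑ x, lawInputsOutput P W (x, z)

/-- The number of messages at rate `R` and block length `n`, that is, the number of integers in
`[1, 2^{nR}]`. -/
def numMessages (R : ℝ) (n : ℕ) : ℕ := ⌊(2 : ℝ) ^ ((n : ℝ) * R)⌋₊

/-- The encoders of a code of block length `n` with degraded message sets, for `N₁` and `N₂`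
messages: the `i`-th symbol of Encoder 1 is a function of `m₁`, that of Encoder 2 a function of
`(m₁, m₂)`. -/
structure DegradedCode (X₁ X₂ : Type*) (N₁ N₂ n : ℕ) where
  /-- `enc₁ i m₁` is the `i`-th symbol sent by Encoder 1. -/
  enc₁ : Fin n → Fin N₁ → X₁
  /-- `enc₂ i m₁ m₂` is the `i`-th symbol sent by Encoder 2. -/
  enc₂ : Fin n → Fin N₁ → Fin N₂ → X₂

/-- The law `P_{Zⁿ}` of the output of the memoryless channel `W` when the two messages are
independent and uniform and are encoded by the code `c`. -/
def DegradedCode.inducedLaw {N₁ N₂ n : ℕ} (c : DegradedCode X₁ X₂ N₁ N₂ n)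
    (W : X₁ → X₂ → Z → ℝ) : (Fin n → Z) → ℝ :=
  fun z => ((N₁ : ℝ) * N₂)⁻¹ * ∑ m₁, ∑ m₂, ∏ i, W (c.enc₁ i m₁) (c.enc₂ i m₁ m₂) (z i)

/-- The pair of rates `R = (R₁, R₂)` is achievable: some sequence of `(2^{nR₁}, 2^{nR₂}, n)` codes
has `D(P_{Zⁿ} ‖ Q^{⊗n}) → 0` (no normalization by `n`). -/
def IsAchievable [Fintype Z] (W : X₁ → X₂ → Z → ℝ) (Q : Z → ℝ) (R : ℝ × ℝ) : Prop :=
  0 ≤ R.1 ∧ 0 ≤ R.2 ∧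
    ∃ c : ∀ n : ℕ, DegradedCode X₁ X₂ (numMessages R.1 n) (numMessages R.2 n) n,
      Filter.Tendsto (fun n => relEntropy ((c n).inducedLaw W) (iidLaw Q n)) Filter.atTop (nhds 0)

/-- The resolvability region for the target law `Q`: the closure of the set of achievable pairs. -/
def resolvabilityRegion [Fintype Z] (W : X₁ → X₂ → Z → ℝ) (Q : Z → ℝ) : Set (ℝ × ℝ) :=
  closure {R | IsAchievable W Q R}

end MACResolvability

end

open scoped BigOperators

noncomputable section

namespace MACResolvability

/-! Achievability is random superposition coding. Factor the law as `p(x₁) K(x₂|x₁)`; each `m₁`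
draws a cloud centre, each `(m₁, m₂)` a satellite given its centre. For `0 < s ≤ 1`, under absolute
continuity, `∑ P_{Zⁿ} (P_{Zⁿ}/Qⁿ)^s` is at least `1 + s · ln 2 · D(P_{Zⁿ}‖Qⁿ)`. To estimate its mean
over codebooks, single out one codeword: the others are independent of it, and concavity of `x ↦ x ^
s` lets their average be replaced by its mean (`soft_covering`). Applied to clouds and then to
satellites, this gives `superposition_covering`; summed over outputs, the bound is `1` plus two
errors, with factors `N₁^(-s)` and `(N₁N₂)^(-s)` in front of `n`-th powers of single-letter moments.
To first order in small `s` those moments are `2^(s I(X₁;Z))` and `2^(s I(X₁,X₂;Z))`, so strict rate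
inequalities make both errors decay exponentially (`eventually_rpow_mul_moment_lt_one`). The closure
absorbs the strictness.

For the converse, let `J` be the time-averaged joint law of an input letter and the output letter.
Gibbs' inequality compares each message's output law with the product of the conditional laws of
`J`; moreover each message's output law is at most `|M|` times the overall output law. Together they
give `n ∑ J log (J / (J_X Q)) ≤ log |M| + D(P_{Zⁿ}‖Qⁿ)` in nats (`single_letter_bound`). With a
trivial message, with `m₁`, and with `(m₁, m₂)`, this shows that the averaged input has output law
close to `Q` and informations exceeding the rates by `O(1/n)`. Compactness of the simplex and
continuity of mutual information then produce an exact law. -/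

/-! ### Finite sums over product spaces -/

/-- Summing a product of one-letter functions over all words. -/
lemma sum_prod_word {ι α : Type*} [Fintype ι] [DecidableEq ι] [Fintype α] (f : ι → α → ℝ) :
    ∑ x : ι → α, ∏ i, f i (x i) = ∏ i, ∑ a, f i a := by
  rw [Finset.prod_univ_sum, Fintype.piFinset_univ]

/-- Every factor but the `j`-th sums to one. The weights depend on the index because channel outputs
given a codeword are independent but not identically distributed. -/
lemma sum_prod_word_mul {ι α : Type*} [Fintype ι] [DecidableEq ι] [Fintype α] (w : ι → α → ℝ)
    (hw : ∀ i, ∑ a, w i a = 1) (j : ι) (h : α → ℝ) :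
    ∑ x : ι → α, (∏ i, w i (x i)) * h (x j) = ∑ a, w j a * h a := by
  have e : ∀ x : ι → α, (∏ i, w i (x i)) * h (x j)
      = ∏ i, (w i (x i) * if i = j then h (x i) else 1) := by
    intro x
    rw [Finset.prod_mul_distrib, Finset.prod_ite_eq' Finset.univ j (fun i => h (x i))]
    simp
  simp_rw [e]
  rw [sum_prod_word (fun i a => w i a * if i = j then h a else 1)]
  rw [Finset.prod_eq_single j]
  · simp
  · intro b _ hb
    simp [hb, hw]
  · simp

/-- Independence of two distinct coordinates; it kills the linear term in `soft_covering`. -/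
lemma sum_prod_word_mul_mul {ι α : Type*} [Fintype ι] [DecidableEq ι] [Fintype α] (w : α → ℝ)
    (hw : ∑ a, w a = 1) {j k : ι} (hjk : j ≠ k) (g h : α → ℝ) :
    ∑ x : ι → α, (∏ i, w (x i)) * (g (x j) * h (x k)) = (∑ a, w a * g a) * ∑ a, w a * h a := by
  have e : ∀ x : ι → α, (∏ i, w (x i)) * (g (x j) * h (x k))
      = ∏ i, (w (x i) * ((if i = j then g (x i) else 1) * if i = k then h (x i) else 1)) := by
    intro x
    rw [Finset.prod_mul_distrib, Finset.prod_mul_distrib,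
      Finset.prod_ite_eq' Finset.univ j (fun i => g (x i)),
      Finset.prod_ite_eq' Finset.univ k (fun i => h (x i))]
    simp
  simp_rw [e]
  rw [sum_prod_word (fun i a => w a * ((if i = j then g a else 1) * if i = k then h a else 1))]
  rw [Finset.prod_eq_mul j k hjk]
  · simp [hjk, hjk.symm]
  · intro c _ hc
    simp [hc.1, hc.2, hw]
  · simp
  · simp

/-! ### Soft covering -/

/-- The graph of `x ↦ x ^ s` lies below its tangent at `t`. -/
lemma rpow_le_tangent {s x t : ℝ} (hs0 : 0 ≤ s) (hs1 : s ≤ 1) (hx : 0 ≤ x) (ht : 0 < t) :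
    x ^ s ≤ t ^ s + s * t ^ s / t * (x - t) := by
  have h := rpow_one_add_le_one_add_mul_self (s := x / t - 1) (p := s)
    (by linarith [div_nonneg hx ht.le]) hs0 hs1
  rw [add_sub_cancel, Real.div_rpow hx ht.le, div_le_iff₀ (Real.rpow_pos_of_pos ht s)] at h
  refine h.trans_eq ?_
  field_simp

/-- A random codebook of `N` independent words of law `w`: the moment of order `1 + s` of
its average output is controlled by one word and the mean. -/
lemma soft_covering {Ω : Type*} [Fintype Ω] {w U : Ω → ℝ} (hw : ∀ ω, 0 ≤ w ω)
    (hw1 : ∑ ω, w ω = 1) (hU : ∀ ω, 0 ≤ U ω) {N : ℕ} (hN : 0 < N) {s c : ℝ} (hs0 : 0 ≤ s)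
    (hs1 : s ≤ 1) (hc : 0 ≤ c) :
    ∑ C : Fin N → Ω, (∏ m, w (C m)) *
        (((N : ℝ)⁻¹ * ∑ m, U (C m)) * ((N : ℝ)⁻¹ * ∑ m, U (C m) + c) ^ s)
      ≤ ∑ ω, w ω * (U ω * (U ω / N + ∑ ω', w ω' * U ω' + c) ^ s) := by
  have hN' : (0 : ℝ) < N := by exact_mod_cast hN
  set E := ∑ ω', w ω' * U ω' with hE
  have hE0 : 0 ≤ E := Finset.sum_nonneg fun ω _ => mul_nonneg (hw ω) (hU ω)
  -- An upper bound for the conditional mean of the average plus `c`, given that one word is `ω`.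
  -- With the tangent taken at `t`, what remains is linear in the centred terms `U (C m) - E`, which
  -- have mean zero.
  set t : Ω → ℝ := fun ω => U ω / N + E + c with ht
  have hwC : ∀ C : Fin N → Ω, 0 ≤ ∏ m, w (C m) := fun C => Finset.prod_nonneg fun m _ => hw _
  have key : ∀ m₀ : Fin N, ∑ C : Fin N → Ω, (∏ m, w (C m)) *
      (U (C m₀) * ((N : ℝ)⁻¹ * ∑ m, U (C m) + c) ^ s) ≤ ∑ ω, w ω * (U ω * t ω ^ s) := by
    intro m₀
    set g : Ω → ℝ := fun ω => U ω * (s * t ω ^ s / t ω) with hg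
    have hpt : ∀ C : Fin N → Ω, U (C m₀) * ((N : ℝ)⁻¹ * ∑ m, U (C m) + c) ^ s
        ≤ U (C m₀) * t (C m₀) ^ s
          + (N : ℝ)⁻¹ * ∑ m ∈ Finset.univ.erase m₀, g (C m₀) * (U (C m) - E) := by
      intro C
      -- If `U (C m₀) = 0`, then `t` may vanish and there is no tangent, but both sides are zero.
      rcases (hU (C m₀)).eq_or_lt with h0 | h0
      · simp [hg, ← h0]
      have ht0 : 0 < t (C m₀) := by
        have := div_pos h0 hN'
        simp only [ht]; linarith
      have hx : 0 ≤ (N : ℝ)⁻¹ * ∑ m, U (C m) + c :=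
        add_nonneg (mul_nonneg (by positivity) (Finset.sum_nonneg fun m _ => hU _)) hc
      have h1 := rpow_le_tangent hs0 hs1 hx ht0
      have h2 : (N : ℝ)⁻¹ * ∑ m, U (C m) + c - t (C m₀)
          ≤ (N : ℝ)⁻¹ * ∑ m ∈ Finset.univ.erase m₀, (U (C m) - E) := by
        rw [← Finset.add_sum_erase _ _ (Finset.mem_univ m₀), Finset.sum_sub_distrib,
          Finset.sum_const, Finset.card_erase_of_mem (Finset.mem_univ _), Finset.card_univ,
          Fintype.card_fin, nsmul_eq_mul, Nat.cast_sub hN]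
        simp only [ht]
        have : (N : ℝ)⁻¹ * ((N - (1 : ℕ)) * E) = E - (N : ℝ)⁻¹ * E := by
          field_simp; push_cast; ring
        rw [mul_sub, this, mul_add, div_eq_inv_mul]
        have := mul_nonneg (inv_nonneg.2 hN'.le) hE0
        linarith
      have hd : 0 ≤ s * t (C m₀) ^ s / t (C m₀) := by positivity
      calc _ ≤ U (C m₀) * (t (C m₀) ^ s + s * t (C m₀) ^ s / t (C m₀) *
              ((N : ℝ)⁻¹ * ∑ m ∈ Finset.univ.erase m₀, (U (C m) - E))) := by
            refine mul_le_mul_of_nonneg_left (h1.trans ?_) h0.le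
            gcongr
        _ = _ := by
            rw [← Finset.mul_sum]; simp only [hg]; ring
    calc _ ≤ ∑ C : Fin N → Ω, (∏ m, w (C m)) * (U (C m₀) * t (C m₀) ^ s
          + (N : ℝ)⁻¹ * ∑ m ∈ Finset.univ.erase m₀, g (C m₀) * (U (C m) - E)) :=
          Finset.sum_le_sum fun C _ => mul_le_mul_of_nonneg_left (hpt C) (hwC C)
      _ = ∑ C : Fin N → Ω, (∏ m, w (C m)) * (U (C m₀) * t (C m₀) ^ s)
          + (N : ℝ)⁻¹ * ∑ m ∈ Finset.univ.erase m₀,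
            ∑ C : Fin N → Ω, (∏ m, w (C m)) * (g (C m₀) * (U (C m) - E)) := by
          rw [Finset.sum_comm, Finset.mul_sum, ← Finset.sum_add_distrib]
          refine Finset.sum_congr rfl fun C _ => ?_
          simp_rw [mul_add, Finset.mul_sum]
          congr 1
          exact Finset.sum_congr rfl fun m _ => by ring
      _ = _ := by
          rw [sum_prod_word_mul (fun _ => w) (fun _ => hw1) m₀ (fun ω => U ω * t ω ^ s),
            Finset.sum_eq_zero (s := Finset.univ.erase m₀), mul_zero, add_zero]
          intro m hm
          rw [sum_prod_word_mul_mul w hw1 (Finset.ne_of_mem_erase hm).symm g (fun ω => U ω - E)]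
          simp [mul_sub, ← Finset.sum_mul, hw1, ← hE]
  calc _ = (N : ℝ)⁻¹ * ∑ m₀, ∑ C : Fin N → Ω, (∏ m, w (C m)) *
      (U (C m₀) * ((N : ℝ)⁻¹ * ∑ m, U (C m) + c) ^ s) := by
        rw [Finset.sum_comm, Finset.mul_sum]
        refine Finset.sum_congr rfl fun C _ => ?_
        rw [← Finset.mul_sum, ← Finset.sum_mul]; ring
    _ ≤ (N : ℝ)⁻¹ * ∑ m₀ : Fin N, ∑ ω, w ω * (U ω * t ω ^ s) := by
        gcongr with m₀; exact key m₀
    _ = _ := by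
        rw [Finset.sum_const, Finset.card_univ, Fintype.card_fin, nsmul_eq_mul,
          inv_mul_cancel_left₀ hN'.ne']

lemma rpow_add_add_le {x y z s : ℝ} (hx : 0 ≤ x) (hy : 0 ≤ y) (hz : 0 ≤ z) (hs0 : 0 ≤ s)
    (hs1 : s ≤ 1) : (x + y + z) ^ s ≤ x ^ s + y ^ s + z ^ s :=
  (Real.rpow_add_le_add_rpow (add_nonneg hx hy) hz hs0 hs1).trans
    (by gcongr; exact Real.rpow_add_le_add_rpow hx hy hs0 hs1)

/-- A cloud centre of law `p` with `N₂` satellites, independent of law `K a` given the centre `a`. -/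
def cloudLaw {A B : Type*} (p : A → ℝ) (K : A → B → ℝ) {N₂ : ℕ} (ω : A × (Fin N₂ → B)) : ℝ :=
  p ω.1 * ∏ m, K ω.1 (ω.2 m)

/-- The average output over a superposition codebook, at a fixed output letter. -/
def codebookOutput {A B : Type*} (V : A → B → ℝ) {N₁ N₂ : ℕ}
    (C : Fin N₁ → A × (Fin N₂ → B)) : ℝ :=
  (N₁ : ℝ)⁻¹ * ∑ m₁, (N₂ : ℝ)⁻¹ * ∑ m₂, V (C m₁).1 ((C m₁).2 m₂)

lemma cloudLaw_nonneg {A B : Type*} {p : A → ℝ} {K : A → B → ℝ} (hp : ∀ a, 0 ≤ p a)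
    (hK : ∀ a b, 0 ≤ K a b) {N₂ : ℕ} (ω : A × (Fin N₂ → B)) : 0 ≤ cloudLaw p K ω :=
  mul_nonneg (hp _) (Finset.prod_nonneg fun _ _ => hK _ _)

lemma sum_cloudLaw {A B : Type*} [Fintype A] [Fintype B] {p : A → ℝ} {K : A → B → ℝ}
    (hp1 : ∑ a, p a = 1) (hK1 : ∀ a, ∑ b, K a b = 1) (N₂ : ℕ) :
    ∑ ω : A × (Fin N₂ → B), cloudLaw p K ω = 1 := by
  simp only [cloudLaw]
  rw [Fintype.sum_prod_type]
  simp only [← Finset.mul_sum]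
  simp [sum_prod_word (fun (_ : Fin N₂) => K _), hK1, hp1]

/-- Moment bound for the output of a random superposition codebook. -/
lemma superposition_covering {A B : Type*} [Fintype A] [Fintype B] {p : A → ℝ} {K : A → B → ℝ}
    {V : A → B → ℝ} (hp : ∀ a, 0 ≤ p a) (hp1 : ∑ a, p a = 1) (hK : ∀ a b, 0 ≤ K a b)
    (hK1 : ∀ a, ∑ b, K a b = 1) (hV : ∀ a b, 0 ≤ V a b) {N₁ N₂ : ℕ} (hN₁ : 0 < N₁)
    (hN₂ : 0 < N₂) {s q : ℝ} (hs0 : 0 < s) (hs1 : s ≤ 1)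
    (hq : q = ∑ a, p a * ∑ b, K a b * V a b) :
    ∑ C : Fin N₁ → A × (Fin N₂ → B), (∏ m, cloudLaw p K (C m)) *
        (codebookOutput V C * (codebookOutput V C / q) ^ s)
      ≤ q + (N₁ : ℝ)⁻¹ ^ s * ∑ a, ∑ b, p a * K a b * V a b * ((∑ b', K a b' * V a b') / q) ^ s
        + ((N₁ : ℝ) * N₂)⁻¹ ^ s * ∑ a, ∑ b, p a * K a b * V a b * (V a b / q) ^ s := by
  have hN₁' : (0 : ℝ) < N₁ := by exact_mod_cast hN₁
  have hN₂' : (0 : ℝ) < N₂ := by exact_mod_cast hN₂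
  have hV1 : ∀ a, 0 ≤ ∑ b, K a b * V a b := fun a =>
    Finset.sum_nonneg fun b _ => mul_nonneg (hK a b) (hV a b)
  have hq0 : 0 ≤ q := by
    rw [hq]; exact Finset.sum_nonneg fun a _ => mul_nonneg (hp a) (hV1 a)
  set U : A × (Fin N₂ → B) → ℝ := fun ω => (N₂ : ℝ)⁻¹ * ∑ m₂, V ω.1 (ω.2 m₂) with hUdef
  have hU : ∀ ω, 0 ≤ U ω := fun ω =>
    mul_nonneg (inv_nonneg.2 hN₂'.le) (Finset.sum_nonneg fun m _ => hV _ _)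
  have hout : ∀ C : Fin N₁ → A × (Fin N₂ → B),
      codebookOutput V C = (N₁ : ℝ)⁻¹ * ∑ m, U (C m) := fun C => rfl
  have hout0 : ∀ C : Fin N₁ → A × (Fin N₂ → B), 0 ≤ codebookOutput V C := fun C => by
    rw [hout]
    exact mul_nonneg (inv_nonneg.2 hN₁'.le) (Finset.sum_nonneg fun m _ => hU _)
  have hmean : ∑ ω, cloudLaw p K ω * U ω = q := by
    simp only [cloudLaw, hUdef]
    rw [Fintype.sum_prod_type, hq]
    refine Finset.sum_congr rfl fun a _ => ?_
    have : ∀ y : Fin N₂ → B, p a * (∏ m, K a (y m)) * ((N₂ : ℝ)⁻¹ * ∑ m₂, V a (y m₂))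
        = p a * ((N₂ : ℝ)⁻¹ * ∑ m₂, (∏ m, K a (y m)) * V a (y m₂)) := fun y => by
      rw [← Finset.mul_sum]; ring
    simp only [this]
    rw [← Finset.mul_sum, ← Finset.mul_sum, Finset.sum_comm]
    simp only [sum_prod_word_mul (fun _ => K a) (fun _ => hK1 a)]
    simp [hN₂'.ne']
  have h1 := soft_covering (w := cloudLaw p K) (U := U) (cloudLaw_nonneg hp hK)
    (sum_cloudLaw hp1 hK1 N₂) hU hN₁ hs0.le hs1 le_rfl
  simp only [← hout, add_zero, hmean] at h1
  have h2 : ∀ a, ∑ y : Fin N₂ → B, (∏ m, K a (y m)) * (U (a, y) * (U (a, y) / N₁ + q) ^ s)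
      ≤ ∑ b, K a b * (V a b * (V a b / (N₁ * N₂) + (∑ b', K a b' * V a b') / N₁ + q) ^ s) := by
    intro a
    -- Second use, inside one cloud: the contribution `q` of the other clouds enters as the constant
    -- `c`.
    have h := soft_covering (w := K a) (U := fun b => V a b / N₁) (hK a) (hK1 a)
      (fun b => div_nonneg (hV a b) hN₁'.le) hN₂ hs0.le hs1 hq0
    have h' := mul_le_mul_of_nonneg_left h hN₁'.le
    rw [Finset.mul_sum, Finset.mul_sum] at h'
    refine le_of_eq_of_le (Finset.sum_congr rfl fun y _ => ?_)
      (h'.trans_eq (Finset.sum_congr rfl fun b _ => ?_))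
    · rw [← Finset.sum_div, ← mul_div_assoc]
      simp only [hUdef]
      field_simp
    · rw [div_div]
      simp only [mul_div_assoc', ← Finset.sum_div]
      field_simp
  have h3 : ∑ ω, cloudLaw p K ω * (U ω * (U ω / N₁ + q) ^ s)
      ≤ ∑ a, ∑ b, p a * K a b * V a b *
        (V a b / (N₁ * N₂) + (∑ b', K a b' * V a b') / N₁ + q) ^ s := by
    rw [Fintype.sum_prod_type]
    refine Finset.sum_le_sum fun a _ => ?_
    have := mul_le_mul_of_nonneg_left (h2 a) (hp a)
    rw [Finset.mul_sum, Finset.mul_sum] at this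
    refine le_of_eq_of_le (Finset.sum_congr rfl fun y _ => ?_)
      (this.trans_eq (Finset.sum_congr rfl fun b _ => ?_))
    · simp only [cloudLaw]; ring
    · ring
  have h4 : ∑ C : Fin N₁ → A × (Fin N₂ → B), (∏ m, cloudLaw p K (C m)) *
        (codebookOutput V C * (codebookOutput V C / q) ^ s)
      = (∑ C : Fin N₁ → A × (Fin N₂ → B), (∏ m, cloudLaw p K (C m)) *
        (codebookOutput V C * codebookOutput V C ^ s)) * (q ^ s)⁻¹ := by
    rw [Finset.sum_mul]
    refine Finset.sum_congr rfl fun C _ => ?_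
    rw [Real.div_rpow (hout0 C) hq0]; ring
  have hqs : 0 ≤ (q ^ s)⁻¹ := inv_nonneg.2 (Real.rpow_nonneg hq0 s)
  rw [h4]
  refine (mul_le_mul_of_nonneg_right (h1.trans h3) hqs).trans ?_
  have h5 : q = ∑ a, ∑ b, p a * K a b * V a b := by
    rw [hq]
    refine Finset.sum_congr rfl fun a _ => ?_
    rw [Finset.mul_sum]
    exact Finset.sum_congr rfl fun b _ => by ring
  conv_rhs => enter [1, 1]; rw [h5]
  simp only [Finset.sum_mul, Finset.mul_sum, ← Finset.sum_add_distrib]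
  refine Finset.sum_le_sum fun a _ => Finset.sum_le_sum fun b _ => ?_
  have hw : 0 ≤ p a * K a b * V a b := mul_nonneg (mul_nonneg (hp a) (hK a b)) (hV a b)
  have h6 := rpow_add_add_le (div_nonneg (hV a b) (mul_pos hN₁' hN₂').le)
    (div_nonneg (hV1 a) hN₁'.le) hq0 hs0.le hs1
  -- An inequality only, so that `q = 0` is included.
  have h7 : q ^ s * (q ^ s)⁻¹ ≤ 1 := mul_inv_le_one
  rw [Real.div_rpow (hV a b) (mul_pos hN₁' hN₂').le, Real.div_rpow (hV1 a) hN₁'.le] at h6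
  rw [Real.div_rpow (hV a b) hq0, Real.div_rpow (hV1 a) hq0, Real.inv_rpow hN₁'.le,
    Real.inv_rpow (mul_pos hN₁' hN₂').le]
  have h8 := mul_le_mul_of_nonneg_left (mul_le_mul_of_nonneg_right h6 hqs) hw
  have h9 := mul_le_mul_of_nonneg_left h7 hw
  simp only [div_eq_mul_inv] at h8 ⊢
  linarith

/-! ### Achievability -/

/-- A random variable of negative mean logarithm has a fractional moment below one. -/
lemma eventually_sum_mul_rpow_lt_one {J : Type*} [Fintype J] {q r : J → ℝ}
    (hq1 : ∑ j, q j = 1) (hr : ∀ j, q j ≠ 0 → 0 < r j)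
    (h : ∑ j, q j * Real.log (r j) < 0) :
    ∀ᶠ s in nhdsWithin (0 : ℝ) (Set.Ioi 0), ∑ j, q j * r j ^ s < 1 := by
  -- The moment equals `1` at `s = 0`, with derivative the mean logarithm, so it drops below `1`
  -- just to the right.
  have hd : HasDerivAt (fun s : ℝ => ∑ j, q j * r j ^ s) (∑ j, q j * Real.log (r j)) 0 := by
    refine HasDerivAt.fun_sum fun j _ => ?_
    by_cases hj : q j = 0
    · simpa [hj] using hasDerivAt_const (0 : ℝ) (0 : ℝ)
    · have := ((Real.hasStrictDerivAt_const_rpow (hr j hj) 0).hasDerivAt).const_mul (q j)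
      simpa using this
  have h0 : ∑ j, q j * r j ^ (0 : ℝ) = 1 := by simpa using hq1
  have hs := (hasDerivAt_iff_tendsto_slope.1 hd).eventually (eventually_lt_nhds h)
  have hs' := hs.filter_mono
    (nhdsWithin_mono (0 : ℝ) (fun x (hx : x ∈ Set.Ioi (0 : ℝ)) => (ne_of_gt hx : x ≠ 0)))
  filter_upwards [hs', self_mem_nhdsWithin] with s hs hpos
  rw [slope_def_field, h0, sub_zero, div_neg_iff] at hs
  rcases hs with hs | hs
  · exact absurd hs.2 (not_lt.2 (le_of_lt hpos))
  · linarith [hs.1]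

/-- A joint law on a product of finite alphabets disintegrates. -/
lemma exists_kernel {X₁ X₂ : Type*} [Fintype X₁] [Fintype X₂] {P : X₁ × X₂ → ℝ}
    (hP : P ∈ stdSimplex ℝ (X₁ × X₂)) :
    ∃ (p : X₁ → ℝ) (K : X₁ → X₂ → ℝ), (∀ a, 0 ≤ p a) ∧ ∑ a, p a = 1 ∧ (∀ a b, 0 ≤ K a b) ∧
      (∀ a, ∑ b, K a b = 1) ∧ ∀ a b, P (a, b) = p a * K a b := by
  classical
  have hne : Nonempty X₂ := by
    by_contra hemp
    rw [not_nonempty_iff] at hemp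
    simpa using hP.2
  obtain ⟨b₀⟩ := hne
  -- Rows of zero mass get a point mass at `b₀`, so that `K a` is a probability law for every `a`.
  refine ⟨fun a => ∑ b, P (a, b), fun a b => if ∑ b', P (a, b') = 0 then
    (if b = b₀ then 1 else 0) else P (a, b) / ∑ b', P (a, b'),
    fun a => Finset.sum_nonneg fun b _ => hP.1 _, ?_, ?_, ?_, ?_⟩
  · rw [← Fintype.sum_prod_type]; exact hP.2
  · intro a b
    dsimp only
    split_ifs
    · exact zero_le_one
    · exact le_rfl
    · exact div_nonneg (hP.1 _) (Finset.sum_nonneg fun b _ => hP.1 _)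
  · intro a
    dsimp only
    split_ifs with h
    · simp
    · rw [← Finset.sum_div, div_self h]
  · intro a b
    dsimp only
    split_ifs with h h'
    · rw [h, zero_mul]
      exact (Finset.sum_eq_zero_iff_of_nonneg fun b _ => hP.1 (a, b)).1 h b (Finset.mem_univ b)
    · rw [h, zero_mul]
      exact (Finset.sum_eq_zero_iff_of_nonneg fun b _ => hP.1 (a, b)).1 h b (Finset.mem_univ b)
    · rw [mul_div_cancel₀ _ h]

/-! ### Bounds on relative entropy -/

lemma relEntropy_of_forall {α : Type*} [Fintype α] {P Q : α → ℝ} (h : ∀ a, Q a = 0 → P a = 0) :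
    relEntropy P Q = ((∑ a, P a * Real.logb 2 (P a / Q a) : ℝ) : EReal) := by
  rw [relEntropy, if_neg]
  rintro ⟨a, h1, h2⟩
  exact h1 (h a h2)

/-- Relative entropy is bounded by the Rényi-type moment of any positive order. -/
lemma relEntropy_le_moment {α : Type*} [Fintype α] {P Q : α → ℝ} (hP : ∀ a, 0 ≤ P a)
    (hP1 : ∑ a, P a = 1) (hQ : ∀ a, 0 ≤ Q a) (h : ∀ a, Q a = 0 → P a = 0) {s : ℝ} (hs : 0 < s) :
    relEntropy P Q
      ≤ (((∑ a, P a * (P a / Q a) ^ s - 1) / (s * Real.log 2) : ℝ) : EReal) := by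
  rw [relEntropy_of_forall h, EReal.coe_le_coe_iff, ← hP1, ← Finset.sum_sub_distrib,
    Finset.sum_div]
  have hl2 : 0 < Real.log 2 := Real.log_pos (by norm_num)
  refine Finset.sum_le_sum fun a _ => ?_
  rcases (hP a).eq_or_lt with h0 | h0
  · simp [← h0]
  have hQ0 : 0 < Q a := (hQ a).lt_of_ne fun h' => h0.ne' (h a h'.symm)
  have hr : 0 < P a / Q a := div_pos h0 hQ0
  have h1 := Real.log_le_sub_one_of_pos (Real.rpow_pos_of_pos hr s)
  rw [Real.log_rpow hr] at h1
  rw [Real.logb, le_div_iff₀ (by positivity)]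
  have h2 := mul_le_mul_of_nonneg_left h1 h0.le
  calc _ = P a * (s * Real.log (P a / Q a)) := by field_simp
    _ ≤ _ := by linarith

/-- Gibbs' inequality. -/
lemma sum_mul_log_div_nonneg {α : Type*} [Fintype α] {P Q : α → ℝ} (hP : ∀ a, 0 ≤ P a)
    (hQ : ∀ a, 0 ≤ Q a) (hPQ : ∑ a, Q a ≤ ∑ a, P a) (h : ∀ a, Q a = 0 → P a = 0) :
    0 ≤ ∑ a, P a * Real.log (P a / Q a) := by
  refine (sub_nonneg.2 hPQ).trans ?_
  rw [← Finset.sum_sub_distrib]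
  refine Finset.sum_le_sum fun a _ => ?_
  rcases (hP a).eq_or_lt with h0 | h0
  · simp [← h0, hQ a]
  have hQ0 : 0 < Q a := (hQ a).lt_of_ne fun h' => h0.ne' (h a h'.symm)
  have h1 := Real.one_sub_inv_le_log_of_pos (div_pos h0 hQ0)
  have h2 := mul_le_mul_of_nonneg_left h1 h0.le
  have h3 : P a * (1 - (P a / Q a)⁻¹) = P a - Q a := by field_simp
  linarith

lemma sum_mul_logb {α : Type*} [Fintype α] (P Q : α → ℝ) :
    ∑ a, P a * Real.logb 2 (P a / Q a) = (∑ a, P a * Real.log (P a / Q a)) / Real.log 2 := by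
  rw [Finset.sum_div]
  exact Finset.sum_congr rfl fun a _ => by rw [Real.logb]; ring

lemma relEntropy_nonneg {α : Type*} [Fintype α] {P Q : α → ℝ} (hP : ∀ a, 0 ≤ P a)
    (hQ : ∀ a, 0 ≤ Q a) (hPQ : ∑ a, Q a ≤ ∑ a, P a) : 0 ≤ relEntropy P Q := by
  by_cases h : ∀ a, Q a = 0 → P a = 0
  · rw [relEntropy_of_forall h, sum_mul_logb]
    exact_mod_cast div_nonneg (sum_mul_log_div_nonneg hP hQ hPQ h)
      (Real.log_pos (by norm_num)).le
  · push Not at h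
    obtain ⟨a, h1, h2⟩ := h
    rw [relEntropy, if_pos ⟨a, h2, h1⟩]
    exact le_top

/-! ### Output laws and random superposition codes -/

/-- Tensorization: this turns the `n`-letter moments into `n`-th powers of single-letter ones. -/
lemma sum_word₃ {A B C : Type*} [Fintype A] [Fintype B] [Fintype C] (g : C → A → B → ℝ) (n : ℕ) :
    ∑ z : Fin n → C, ∑ a : Fin n → A, ∑ b : Fin n → B, ∏ i, g (z i) (a i) (b i)
      = (∑ z, ∑ a, ∑ b, g z a b) ^ n := by
  have h1 : ∀ (z : Fin n → C) (a : Fin n → A), ∑ b : Fin n → B, ∏ i, g (z i) (a i) (b i)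
      = ∏ i, ∑ b, g (z i) (a i) b := fun z a => sum_prod_word fun i b => g (z i) (a i) b
  have h2 : ∀ (z : Fin n → C), ∑ a : Fin n → A, ∏ i, ∑ b, g (z i) (a i) b
      = ∏ i, ∑ a, ∑ b, g (z i) a b := fun z => sum_prod_word fun i a => ∑ b, g (z i) a b
  simp only [h1, h2]
  rw [sum_prod_word (fun _ z => ∑ a, ∑ b, g z a b)]
  simp

lemma prod_div_rpow {n : ℕ} {f g : Fin n → ℝ} (hf : ∀ i, 0 ≤ f i) (hg : ∀ i, 0 ≤ g i) (s : ℝ) :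
    ((∏ i, f i) / ∏ i, g i) ^ s = ∏ i, (f i / g i) ^ s := by
  rw [← Finset.prod_div_distrib, Real.finsetProd_rpow _ _ fun i _ => div_nonneg (hf i) (hg i)]

lemma iidLaw_nonneg {Z : Type*} {Q : Z → ℝ} (hQ : ∀ z, 0 ≤ Q z) (n : ℕ) (z : Fin n → Z) :
    0 ≤ iidLaw Q n z := Finset.prod_nonneg fun _ _ => hQ _

lemma sum_iidLaw {Z : Type*} [Fintype Z] {Q : Z → ℝ} (hQ : ∑ z, Q z = 1) (n : ℕ) :
    ∑ z, iidLaw Q n z = 1 := by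
  simp only [iidLaw]
  rw [sum_prod_word (fun _ => Q)]
  simp [hQ]

variable {X₁ X₂ Z : Type*} [Fintype Z] {W : X₁ → X₂ → Z → ℝ}

lemma DegradedCode.inducedLaw_nonneg (hW : IsChannel W) {N₁ N₂ n : ℕ}
    (c : DegradedCode X₁ X₂ N₁ N₂ n) (z : Fin n → Z) : 0 ≤ c.inducedLaw W z :=
  mul_nonneg (by positivity) (Finset.sum_nonneg fun _ _ => Finset.sum_nonneg fun _ _ =>
    Finset.prod_nonneg fun _ _ => (hW _ _).1 _)

lemma DegradedCode.sum_inducedLaw (hW : IsChannel W) {N₁ N₂ n : ℕ} (hN₁ : 0 < N₁) (hN₂ : 0 < N₂)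
    (c : DegradedCode X₁ X₂ N₁ N₂ n) : ∑ z, c.inducedLaw W z = 1 := by
  have h : ∀ m₁ m₂, ∑ z : Fin n → Z, ∏ i, W (c.enc₁ i m₁) (c.enc₂ i m₁ m₂) (z i) = 1 := by
    intro m₁ m₂
    rw [sum_prod_word (fun i => W (c.enc₁ i m₁) (c.enc₂ i m₁ m₂))]
    exact Finset.prod_eq_one fun i _ => (hW _ _).2
  simp only [DegradedCode.inducedLaw]
  rw [← Finset.mul_sum, Finset.sum_comm]
  have h' : ∀ m₁, ∑ z : Fin n → Z, ∑ m₂, ∏ i, W (c.enc₁ i m₁) (c.enc₂ i m₁ m₂) (z i) = N₂ := by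
    intro m₁
    rw [Finset.sum_comm]
    simp [h]
  simp only [h', Finset.sum_const, Finset.card_univ, Fintype.card_fin, nsmul_eq_mul]
  field_simp

/-- Random superposition coding: some code has positive probability and beats the average. -/
lemma exists_code [Fintype X₁] [Fintype X₂] (hW : IsChannel W) {Q : Z → ℝ} (hQ : Q ∈ stdSimplex ℝ Z) {p : X₁ → ℝ}
    {K : X₁ → X₂ → ℝ} (hp : ∀ a, 0 ≤ p a) (hp1 : ∑ a, p a = 1) (hK : ∀ a b, 0 ≤ K a b)
    (hK1 : ∀ a, ∑ b, K a b = 1) (hout : ∀ z, ∑ a, p a * ∑ b, K a b * W a b z = Q z)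
    {s : ℝ} (hs0 : 0 < s) (hs1 : s ≤ 1) {N₁ N₂ : ℕ} (n : ℕ) (hN₁ : 0 < N₁) (hN₂ : 0 < N₂) :
    ∃ c : DegradedCode X₁ X₂ N₁ N₂ n, (∀ z, iidLaw Q n z = 0 → c.inducedLaw W z = 0) ∧
      ∑ z, c.inducedLaw W z * (c.inducedLaw W z / iidLaw Q n z) ^ s ≤
        1 + (N₁ : ℝ)⁻¹ ^ s * (∑ z, ∑ a, ∑ b, p a * K a b * W a b z *
              ((∑ b', K a b' * W a b' z) / Q z) ^ s) ^ n
          + ((N₁ : ℝ) * N₂)⁻¹ ^ s * (∑ z, ∑ a, ∑ b, p a * K a b * W a b z *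
              (W a b z / Q z) ^ s) ^ n := by
  set pn : (Fin n → X₁) → ℝ := fun a => ∏ i, p (a i) with hpn
  set Kn : (Fin n → X₁) → (Fin n → X₂) → ℝ := fun a b => ∏ i, K (a i) (b i) with hKn
  set Vn : (Fin n → Z) → (Fin n → X₁) → (Fin n → X₂) → ℝ :=
    fun z a b => ∏ i, W (a i) (b i) (z i) with hVn
  have hW0 : ∀ a b z, 0 ≤ W a b z := fun a b z => (hW a b).1 z
  have hpn0 : ∀ a, 0 ≤ pn a := fun a => Finset.prod_nonneg fun i _ => hp _
  have hKn0 : ∀ a b, 0 ≤ Kn a b := fun a b => Finset.prod_nonneg fun i _ => hK _ _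
  have hVn0 : ∀ z a b, 0 ≤ Vn z a b := fun z a b => Finset.prod_nonneg fun i _ => hW0 _ _ _
  have hpn1 : ∑ a, pn a = 1 := by
    simp only [hpn]; rw [sum_prod_word (fun _ => p)]; simp [hp1]
  have hKn1 : ∀ a, ∑ b, Kn a b = 1 := fun a => by
    simp only [hKn]; rw [sum_prod_word (fun i => K (a i))]; simp [hK1]
  have hV1 : ∀ (z : Fin n → Z) a, ∑ b, Kn a b * Vn z a b
      = ∏ i, ∑ b, K (a i) b * W (a i) b (z i) := fun z a => by
    simp only [hKn, hVn, ← Finset.prod_mul_distrib]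
    exact sum_prod_word fun i b => K (a i) b * W (a i) b (z i)
  have hQn : ∀ z : Fin n → Z, iidLaw Q n z = ∑ a, pn a * ∑ b, Kn a b * Vn z a b := fun z => by
    simp only [hV1, hpn, ← Finset.prod_mul_distrib]
    rw [sum_prod_word fun i a => p a * ∑ b, K a b * W a b (z i)]
    simp only [hout, iidLaw]
  have hcov := fun z => superposition_covering hpn0 hpn1 hKn0 hKn1 (hVn0 z) hN₁ hN₂ hs0 hs1 (hQn z)
  have hsum := Finset.sum_le_sum fun z (_ : z ∈ Finset.univ) => hcov z
  have e1 : ∑ z : Fin n → Z, ∑ a, ∑ b, pn a * Kn a b * Vn z a b *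
      ((∑ b', Kn a b' * Vn z a b') / iidLaw Q n z) ^ s
      = (∑ z, ∑ a, ∑ b, p a * K a b * W a b z *
              ((∑ b', K a b' * W a b' z) / Q z) ^ s) ^ n := by
    rw [← sum_word₃]
    refine Finset.sum_congr rfl fun z _ => Finset.sum_congr rfl fun a _ =>
      Finset.sum_congr rfl fun b _ => ?_
    rw [hV1, iidLaw, prod_div_rpow (fun i => Finset.sum_nonneg fun b _ =>
      mul_nonneg (hK _ _) (hW0 _ _ _)) (fun i => hQ.1 _)]
    simp only [hpn, hKn, hVn, Finset.prod_mul_distrib]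
  have e2 : ∑ z : Fin n → Z, ∑ a, ∑ b, pn a * Kn a b * Vn z a b *
      (Vn z a b / iidLaw Q n z) ^ s
      = (∑ z, ∑ a, ∑ b, p a * K a b * W a b z * (W a b z / Q z) ^ s) ^ n := by
    rw [← sum_word₃]
    refine Finset.sum_congr rfl fun z _ => Finset.sum_congr rfl fun a _ =>
      Finset.sum_congr rfl fun b _ => ?_
    simp only [hVn]
    rw [iidLaw, prod_div_rpow (fun i => hW0 _ _ _) (fun i => hQ.1 _)]
    simp only [hpn, hKn, Finset.prod_mul_distrib]
  rw [Finset.sum_add_distrib, Finset.sum_add_distrib, ← Finset.mul_sum, ← Finset.mul_sum, e1, e2,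
    sum_iidLaw hQ.2, Finset.sum_comm] at hsum
  set M := 1 + (N₁ : ℝ)⁻¹ ^ s * (∑ z, ∑ a, ∑ b, p a * K a b * W a b z *
              ((∑ b', K a b' * W a b' z) / Q z) ^ s) ^ n
          + ((N₁ : ℝ) * N₂)⁻¹ ^ s * (∑ z, ∑ a, ∑ b, p a * K a b * W a b z *
              (W a b z / Q z) ^ s) ^ n with hM
  simp only [← Finset.mul_sum] at hsum
  set w : (Fin N₁ → (Fin n → X₁) × (Fin N₂ → Fin n → X₂)) → ℝ :=
    fun C => ∏ m, cloudLaw pn Kn (C m) with hw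
  have hw0 : ∀ C, 0 ≤ w C := fun C => Finset.prod_nonneg fun m _ => cloudLaw_nonneg hpn0 hKn0 _
  have hw1 : ∑ C, w C = 1 := by
    simp only [hw]
    rw [sum_prod_word (fun _ => cloudLaw pn Kn)]
    simp [sum_cloudLaw hpn1 hKn1]
  -- Positive weight is what yields absolute continuity below. The moment cannot detect its failure:
  -- where `iidLaw Q n z = 0` the quotient is `0` by convention, and so is its power.
  obtain ⟨C, hC0, hC⟩ : ∃ C, w C ≠ 0 ∧ ∑ z, codebookOutput (Vn z) C *
      (codebookOutput (Vn z) C / iidLaw Q n z) ^ s ≤ M := by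
    by_contra hcon
    push Not at hcon
    obtain ⟨C₀, -, hC₀⟩ : ∃ C ∈ Finset.univ, w C ≠ 0 :=
      Finset.exists_ne_zero_of_sum_ne_zero (by rw [hw1]; exact one_ne_zero)
    have : ∑ C, w C * M < ∑ C, w C * ∑ z, codebookOutput (Vn z) C *
        (codebookOutput (Vn z) C / iidLaw Q n z) ^ s := by
      refine Finset.sum_lt_sum (fun C _ => ?_) ⟨C₀, Finset.mem_univ _, ?_⟩
      · by_cases h : w C = 0
        · simp [h]
        · exact mul_le_mul_of_nonneg_left (hcon C h).le (hw0 C)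
      · exact mul_lt_mul_of_pos_left (hcon C₀ hC₀) ((hw0 C₀).lt_of_ne' hC₀)
    rw [← Finset.sum_mul, hw1, one_mul] at this
    exact absurd hsum (not_le.2 this)
  let c : DegradedCode X₁ X₂ N₁ N₂ n := ⟨fun i m => (C m).1 i, fun i m₁ m₂ => (C m₁).2 m₂ i⟩
  have hc : ∀ z, c.inducedLaw W z = codebookOutput (Vn z) C := fun z => by
    simp only [DegradedCode.inducedLaw, codebookOutput, ← Finset.mul_sum, mul_inv, mul_assoc]
    rfl
  refine ⟨c, fun z hz => ?_, ?_⟩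
  · rw [hc, codebookOutput, Finset.sum_eq_zero, mul_zero]
    intro m₁ _
    rw [Finset.sum_eq_zero, mul_zero]
    intro m₂ _
    have hcl : cloudLaw pn Kn (C m₁) ≠ 0 := Finset.prod_ne_zero_iff.1 hC0 m₁ (Finset.mem_univ _)
    have h1 := left_ne_zero_of_mul hcl
    have h2 := Finset.prod_ne_zero_iff.1 (right_ne_zero_of_mul hcl) m₂ (Finset.mem_univ _)
    rw [hQn] at hz
    have h3 := (Finset.sum_eq_zero_iff_of_nonneg fun a _ => mul_nonneg (hpn0 a)
      (Finset.sum_nonneg fun b _ => mul_nonneg (hKn0 a b) (hVn0 z a b))).1 hz (C m₁).1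
      (Finset.mem_univ _)
    have h4 := (Finset.sum_eq_zero_iff_of_nonneg fun b _ =>
      mul_nonneg (hKn0 (C m₁).1 b) (hVn0 z (C m₁).1 b)).1
      ((mul_eq_zero.1 h3).resolve_left h1) ((C m₁).2 m₂) (Finset.mem_univ _)
    exact (mul_eq_zero.1 h4).resolve_left h2
  · simpa only [hc] using hC

/-! ### Message counts, exponents and the direct part -/

lemma numMessages_pos {R : ℝ} (hR : 0 ≤ R) (n : ℕ) : 0 < numMessages R n := by
  rw [numMessages, Nat.floor_pos]
  exact Real.one_le_rpow (by norm_num) (by positivity)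

/-- The factor `2` pays for the floor: for `x ≥ 1`, `x < ⌊x⌋ + 1 ≤ 2⌊x⌋`. -/
lemma inv_numMessages_le {R : ℝ} (hR : 0 ≤ R) (n : ℕ) :
    (numMessages R n : ℝ)⁻¹ ≤ 2 * ((2 : ℝ) ^ (-R)) ^ n := by
  have h1 : (1 : ℝ) ≤ numMessages R n := by exact_mod_cast numMessages_pos hR n
  have h2 : (2 : ℝ) ^ ((n : ℝ) * R) < numMessages R n + 1 := Nat.lt_floor_add_one _
  have h3 : ((2 : ℝ) ^ (-R)) ^ n = ((2 : ℝ) ^ ((n : ℝ) * R))⁻¹ := by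
    rw [← Real.rpow_natCast, ← Real.rpow_mul (by norm_num), ← Real.rpow_neg (by norm_num)]
    congr 1; ring
  have h4 : 0 < (2 : ℝ) ^ ((n : ℝ) * R) := by positivity
  rw [h3, ← div_eq_mul_inv, inv_le_comm₀ (by linarith) (by positivity), inv_div]
  linarith

/-- Mutual information through the transition law and the output law. -/
lemma mutualInfo_of_kernel {α : Type*} [Fintype α] {p : α → ℝ} {V : α → Z → ℝ} {Q : Z → ℝ}
    {T : α × Z → ℝ} (hT : ∀ a z, T (a, z) = p a * V a z) (hV : ∀ a, ∑ z, V a z = 1)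
    (hQ : ∀ z, ∑ a, p a * V a z = Q z) :
    mutualInfo T = ∑ a, ∑ z, p a * V a z * Real.logb 2 (V a z / Q z) := by
  simp only [mutualInfo, hT, ← Finset.mul_sum, hV, hQ, mul_one]
  refine Finset.sum_congr rfl fun a _ => Finset.sum_congr rfl fun z _ => ?_
  by_cases h : p a = 0
  · simp [h]
  · rw [mul_div_mul_left _ _ h]

/-- For the ratio `2^(-R) V/Q`, the mean logarithm is `log 2` times information minus `R`, hence
negative; `eventually_sum_mul_rpow_lt_one` then applies. -/
lemma eventually_rpow_mul_moment_lt_one {α : Type*} [Fintype α] {p : α → ℝ} {V : α → Z → ℝ}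
    {Q : Z → ℝ} (hp : ∀ a, 0 ≤ p a) (hp1 : ∑ a, p a = 1) (hV : ∀ a z, 0 ≤ V a z)
    (hV1 : ∀ a, ∑ z, V a z = 1) (hQ : ∀ z, ∑ a, p a * V a z = Q z) {R : ℝ}
    (hR : ∑ a, ∑ z, p a * V a z * Real.logb 2 (V a z / Q z) < R) :
    ∀ᶠ s in nhdsWithin (0 : ℝ) (Set.Ioi 0),
      ((2 : ℝ) ^ (-R)) ^ s * ∑ a, ∑ z, p a * V a z * (V a z / Q z) ^ s < 1 := by
  have hl2 : 0 < Real.log 2 := Real.log_pos (by norm_num)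
  have hQ0 : ∀ z, 0 ≤ Q z := fun z => by
    rw [← hQ]; exact Finset.sum_nonneg fun a _ => mul_nonneg (hp a) (hV a z)
  have hpos : ∀ a z, p a * V a z ≠ 0 → 0 < V a z / Q z := by
    intro a z h
    have h1 : 0 < p a * V a z := (mul_nonneg (hp a) (hV a z)).lt_of_ne' h
    refine div_pos ((hV a z).lt_of_ne' (right_ne_zero_of_mul h)) ?_
    rw [← hQ]
    exact h1.trans_le (Finset.single_le_sum (f := fun a => p a * V a z)
      (fun a _ => mul_nonneg (hp a) (hV a z)) (Finset.mem_univ a))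
  have hsum : ∑ j : α × Z, p j.1 * V j.1 j.2 = 1 := by
    rw [Fintype.sum_prod_type]; simp [← Finset.mul_sum, hV1, hp1]
  have h2R : (0 : ℝ) < 2 ^ (-R) := by positivity
  have h := eventually_sum_mul_rpow_lt_one (J := α × Z) (q := fun j => p j.1 * V j.1 j.2)
    (r := fun j => 2 ^ (-R) * (V j.1 j.2 / Q j.2)) hsum
    (fun j hj => mul_pos h2R (hpos j.1 j.2 hj)) ?_
  · filter_upwards [h] with s hs
    refine lt_of_eq_of_lt ?_ hs
    rw [Fintype.sum_prod_type, Finset.mul_sum]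
    refine Finset.sum_congr rfl fun a _ => ?_
    rw [Finset.mul_sum]
    refine Finset.sum_congr rfl fun z _ => ?_
    rw [Real.mul_rpow h2R.le (div_nonneg (hV a z) (hQ0 z))]
    ring
  · have e : ∀ j : α × Z, p j.1 * V j.1 j.2 * Real.log (2 ^ (-R) * (V j.1 j.2 / Q j.2))
        = Real.log 2 * (p j.1 * V j.1 j.2 * Real.logb 2 (V j.1 j.2 / Q j.2)
            - p j.1 * V j.1 j.2 * R) := by
      intro j
      by_cases hj : p j.1 * V j.1 j.2 = 0
      · simp [hj]
      · rw [Real.log_mul h2R.ne' (hpos _ _ hj).ne', Real.log_rpow two_pos, Real.logb]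
        field_simp
        ring
    simp only [e]
    rw [← Finset.mul_sum, Finset.sum_sub_distrib, ← Finset.sum_mul, hsum, one_mul,
      Fintype.sum_prod_type]
    exact mul_neg_of_pos_of_neg hl2 (sub_neg.2 hR)

/-- Rates strictly above the mutual informations are achievable. -/
theorem isAchievable_of_lt [Fintype X₁] [Fintype X₂] (hW : IsChannel W) {Q : Z → ℝ}
    (hQ : Q ∈ stdSimplex ℝ Z) {P : X₁ × X₂ → ℝ} (hP : P ∈ stdSimplex ℝ (X₁ × X₂))
    (hPQ : lawOutput P W = Q) {R : ℝ × ℝ} (hR₁ : 0 ≤ R.1) (hR₂ : 0 ≤ R.2)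
    (h₁ : mutualInfo (lawFirstOutput P W) < R.1)
    (h₂ : mutualInfo (lawInputsOutput P W) < R.1 + R.2) : IsAchievable W Q R := by
  obtain ⟨p, K, hp, hp1, hK, hK1, hPK⟩ := exists_kernel hP
  have hW0 : ∀ a b z, 0 ≤ W a b z := fun a b z => (hW a b).1 z
  set V : X₁ → Z → ℝ := fun a z => ∑ b, K a b * W a b z with hVdef
  have hV : ∀ a z, 0 ≤ V a z := fun a z =>
    Finset.sum_nonneg fun b _ => mul_nonneg (hK a b) (hW0 a b z)
  have hV1 : ∀ a, ∑ z, V a z = 1 := fun a => by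
    simp only [hVdef]
    rw [Finset.sum_comm]
    simp [← Finset.mul_sum, (hW _ _).2, hK1]
  have hout₂ : ∀ z, ∑ x : X₁ × X₂, P x * W x.1 x.2 z = Q z := fun z => by
    rw [← hPQ]; rfl
  have hout₁ : ∀ z, ∑ a, p a * V a z = Q z := fun z => by
    rw [← hout₂, Fintype.sum_prod_type]
    refine Finset.sum_congr rfl fun a _ => ?_
    rw [Finset.mul_sum]
    exact Finset.sum_congr rfl fun b _ => by rw [hPK]; ring
  rw [mutualInfo_of_kernel (p := p) (V := V) (Q := Q) (fun a z => by
    simp only [lawFirstOutput, lawInputsOutput, hPK, hVdef, Finset.mul_sum, mul_assoc]) hV1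
    hout₁] at h₁
  rw [mutualInfo_of_kernel (p := P) (V := fun x => W x.1 x.2) (Q := Q) (fun _ _ => rfl)
    (fun x => (hW _ _).2) hout₂] at h₂
  have ev₁ := eventually_rpow_mul_moment_lt_one hp hp1 hV hV1 hout₁ h₁
  have ev₂ := eventually_rpow_mul_moment_lt_one hP.1 hP.2 (fun (x : X₁ × X₂) => hW0 x.1 x.2)
    (fun x => (hW _ _).2) hout₂ h₂
  have ev₃ : ∀ᶠ s in nhdsWithin (0 : ℝ) (Set.Ioi 0), s ≤ 1 :=
    (eventually_le_nhds one_pos).filter_mono nhdsWithin_le_nhds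
  -- One exponent `s`, independent of `n`, serves both error terms.
  obtain ⟨s, ⟨⟨hs₁, hs₂⟩, hs1⟩, hs0⟩ :=
    (((ev₁.and ev₂).and ev₃).and self_mem_nhdsWithin).exists
  replace hs0 : 0 < s := hs0
  set β₁ := ∑ a, ∑ z, p a * V a z * (V a z / Q z) ^ s with hβ₁
  set β₂ := ∑ x : X₁ × X₂, ∑ z, P x * W x.1 x.2 z * (W x.1 x.2 z / Q z) ^ s with hβ₂
  have e₁ : ∑ z, ∑ a, ∑ b, p a * K a b * W a b z * ((∑ b', K a b' * W a b' z) / Q z) ^ s = β₁ := by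
    rw [hβ₁, Finset.sum_comm]
    refine Finset.sum_congr rfl fun a _ => Finset.sum_congr rfl fun z _ => ?_
    rw [← Finset.sum_mul]
    congr 1
    simp only [hVdef, Finset.mul_sum, mul_assoc]
  have e₂ : ∑ z, ∑ a, ∑ b, p a * K a b * W a b z * (W a b z / Q z) ^ s = β₂ := by
    rw [hβ₂, Finset.sum_comm (s := (Finset.univ : Finset (X₁ × X₂)))]
    refine Finset.sum_congr rfl fun z _ => ?_
    rw [Fintype.sum_prod_type]
    simp only [hPK]
  have hQ0 := hQ.1
  have hβ₁0 : 0 ≤ β₁ := Finset.sum_nonneg fun a _ => Finset.sum_nonneg fun z _ =>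
    mul_nonneg (mul_nonneg (hp a) (hV a z)) (Real.rpow_nonneg (div_nonneg (hV a z) (hQ0 z)) s)
  have hβ₂0 : 0 ≤ β₂ := Finset.sum_nonneg fun x _ => Finset.sum_nonneg fun z _ =>
    mul_nonneg (mul_nonneg (hP.1 x) (hW0 _ _ z))
      (Real.rpow_nonneg (div_nonneg (hW0 _ _ z) (hQ0 z)) s)
  set ρ₁ := ((2 : ℝ) ^ (-R.1)) ^ s * β₁ with hρ₁
  set ρ₂ := ((2 : ℝ) ^ (-(R.1 + R.2))) ^ s * β₂ with hρ₂
  have hρ₁0 : 0 ≤ ρ₁ := by positivity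
  have hρ₂0 : 0 ≤ ρ₂ := by positivity
  have hcode := fun n => exists_code hW hQ hp hp1 hK hK1 hout₁ hs0 hs1 n
    (numMessages_pos hR₁ n) (numMessages_pos hR₂ n)
  simp only [e₁, e₂] at hcode
  choose c hc hcM using hcode
  refine ⟨hR₁, hR₂, c, ?_⟩
  have swap : ∀ (x : ℝ) (n : ℕ), 0 ≤ x → (x ^ n) ^ s = (x ^ s) ^ n := fun x n hx => by
    rw [← Real.rpow_natCast, ← Real.rpow_natCast, ← Real.rpow_mul hx, ← Real.rpow_mul hx, mul_comm]
  have b₁ : ∀ n, (numMessages R.1 n : ℝ)⁻¹ ^ s * β₁ ^ n ≤ 2 ^ s * ρ₁ ^ n := fun n => by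
    rw [hρ₁, mul_pow, ← mul_assoc, ← swap _ _ (by positivity), ← Real.mul_rpow (by norm_num)
      (by positivity)]
    gcongr
    exact inv_numMessages_le hR₁ n
  have b₂ : ∀ n, ((numMessages R.1 n : ℝ) * numMessages R.2 n)⁻¹ ^ s * β₂ ^ n
      ≤ 4 ^ s * ρ₂ ^ n := fun n => by
    rw [hρ₂, mul_pow, ← mul_assoc, ← swap _ _ (by positivity), ← Real.mul_rpow (by norm_num)
      (by positivity)]
    gcongr
    rw [mul_inv]
    refine (mul_le_mul (inv_numMessages_le hR₁ n) (inv_numMessages_le hR₂ n) (by positivity)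
      (by positivity)).trans_eq ?_
    rw [neg_add, Real.rpow_add two_pos, mul_pow]
    ring
  have hlim : Filter.Tendsto (fun n => (((2 ^ s * ρ₁ ^ n + 4 ^ s * ρ₂ ^ n) / (s * Real.log 2) : ℝ)
      : EReal)) Filter.atTop (nhds 0) := by
    rw [← EReal.coe_zero, EReal.tendsto_coe]
    have := (((tendsto_pow_atTop_nhds_zero_of_lt_one hρ₁0 hs₁).const_mul ((2 : ℝ) ^ s)).add
      ((tendsto_pow_atTop_nhds_zero_of_lt_one hρ₂0 hs₂).const_mul ((4 : ℝ) ^ s))).div_const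
      (s * Real.log 2)
    simpa using this
  refine tendsto_of_tendsto_of_tendsto_of_le_of_le tendsto_const_nhds hlim (fun n => ?_)
    (fun n => ?_)
  · refine relEntropy_nonneg ((c n).inducedLaw_nonneg hW) (iidLaw_nonneg hQ0 n) ?_
    rw [sum_iidLaw hQ.2, (c n).sum_inducedLaw hW (numMessages_pos hR₁ n) (numMessages_pos hR₂ n)]
  · refine (relEntropy_le_moment ((c n).inducedLaw_nonneg hW)
      ((c n).sum_inducedLaw hW (numMessages_pos hR₁ n) (numMessages_pos hR₂ n))
      (iidLaw_nonneg hQ0 n) (hc n) hs0).trans ?_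
    rw [EReal.coe_le_coe_iff]
    have hl2 : 0 < Real.log 2 := Real.log_pos (by norm_num)
    gcongr
    linarith [hcM n, b₁ n, b₂ n]

/-! ### Converse -/

/-- Relative entropy (in nats) dominates the squared Hellinger distance. -/
lemma hellinger_le_sum_mul_log {α : Type*} [Fintype α] {P Q : α → ℝ} (hP : ∀ a, 0 ≤ P a)
    (hQ : ∀ a, 0 ≤ Q a) (hP1 : ∑ a, P a = 1) (hQ1 : ∑ a, Q a = 1) (h : ∀ a, Q a = 0 → P a = 0) :
    ∑ a, (√(P a) - √(Q a)) ^ 2 ≤ ∑ a, P a * Real.log (P a / Q a) := by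
  -- Equal total masses allow `P + Q` to be traded for `2P`; the claim then holds termwise by `1 -
  -- 1/y ≤ log y` at `y = √P/√Q`.
  have e : ∑ a, (√(P a) - √(Q a)) ^ 2 = ∑ a, (2 * P a - 2 * (√(P a) * √(Q a))) := by
    have : ∑ a, (√(P a) - √(Q a)) ^ 2 = ∑ a, (P a + Q a - 2 * (√(P a) * √(Q a))) :=
      Finset.sum_congr rfl fun a _ => by
        rw [sub_sq, Real.sq_sqrt (hP a), Real.sq_sqrt (hQ a)]; ring
    rw [this]
    simp only [Finset.sum_sub_distrib, Finset.sum_add_distrib, ← Finset.mul_sum, hP1, hQ1]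
    norm_num
  rw [e]
  refine Finset.sum_le_sum fun a _ => ?_
  rcases (hP a).eq_or_lt with h0 | h0
  · simp [← h0]
  have hQ0 : 0 < Q a := (hQ a).lt_of_ne fun h' => h0.ne' (h a h'.symm)
  have hp := Real.sqrt_pos.2 h0
  have hq := Real.sqrt_pos.2 hQ0
  have h1 := Real.one_sub_inv_le_log_of_pos (div_pos hp hq)
  have h2 : Real.log (P a / Q a) = 2 * Real.log (√(P a) / √(Q a)) := by
    rw [← Real.sqrt_div' _ hQ0.le, Real.log_sqrt (div_pos h0 hQ0).le]; ring
  rw [h2]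
  have h3 : 2 * P a - 2 * (√(P a) * √(Q a)) = P a * (2 * (1 - (√(P a) / √(Q a))⁻¹)) := by
    nth_rewrite 3 [← Real.mul_self_sqrt h0.le]
    nth_rewrite 1 [← Real.mul_self_sqrt h0.le]
    field_simp
  rw [h3]
  gcongr

/-- If the words are absolutely continuous with respect to the product law of `Q`, then so is the
output marginal of their time-averaged letter law `J` with respect to `Q`. -/
lemma eq_zero_of_average {M X : Type*} [Fintype M] [Fintype X] {n : ℕ} (hn : 0 < n)
    {x : Fin n → M → X} {V : M → (Fin n → Z) → ℝ} {Q : Z → ℝ}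
    (hVQ : ∀ m z, iidLaw Q n z = 0 → V m z = 0) {J : X × Z → ℝ} (hJ0 : ∀ p, 0 ≤ J p)
    (hJ : ∀ h : X → Z → ℝ, (Fintype.card M : ℝ)⁻¹ * ∑ m, ∑ z, V m z * ∑ i, h (x i m) (z i)
      = n * ∑ a, ∑ z, J (a, z) * h a z) (a : X) (z : Z) (hz : Q z = 0) : J (a, z) = 0 := by
  classical
  -- Test against the indicator of the letter `z`: any word containing it is null for the product
  -- law, hence for every `V m`.
  have h := hJ fun _ z' => if z' = z then 1 else 0
  have h0 : ∀ m, ∀ y : Fin n → Z, V m y * ∑ i, (if y i = z then (1 : ℝ) else 0) = 0 := by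
    intro m y
    by_cases hy : ∃ i, y i = z
    · obtain ⟨i, hi⟩ := hy
      rw [hVQ m y (Finset.prod_eq_zero (Finset.mem_univ i) (by rw [hi, hz])), zero_mul]
    · push Not at hy
      simp [hy]
  simp only [h0, Finset.sum_const_zero, mul_zero, mul_ite, mul_one, Finset.sum_ite_eq',
    Finset.mem_univ, if_true] at h
  have hn' : (n : ℝ) ≠ 0 := by positivity
  exact (Finset.sum_eq_zero_iff_of_nonneg fun a _ => hJ0 (a, z)).1
    ((mul_eq_zero.1 h.symm).resolve_left hn') a (Finset.mem_univ a)

/-- Single-letter lower bound on the number of words whose average approximates a product law. -/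
lemma single_letter_bound {M X : Type*} [Fintype M] [Nonempty M] [Fintype X] {n : ℕ}
    {x : Fin n → M → X} {V : M → (Fin n → Z) → ℝ} (hV0 : ∀ m z, 0 ≤ V m z)
    (hV1 : ∀ m, ∑ z, V m z = 1) {Q : Z → ℝ} (hQ0 : ∀ z, 0 ≤ Q z) {O : (Fin n → Z) → ℝ}
    (hO : ∀ z, O z = (Fintype.card M : ℝ)⁻¹ * ∑ m, V m z)
    (hVQ : ∀ m z, iidLaw Q n z = 0 → V m z = 0) {J : X × Z → ℝ} (hJ0 : ∀ p, 0 ≤ J p)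
    (hJ : ∀ h : X → Z → ℝ, (Fintype.card M : ℝ)⁻¹ * ∑ m, ∑ z, V m z * ∑ i, h (x i m) (z i)
      = n * ∑ a, ∑ z, J (a, z) * h a z) :
    n * ∑ a, ∑ z, J (a, z) * Real.log (J (a, z) / ((∑ z', J (a, z')) * Q z))
      ≤ Real.log (Fintype.card M) + ∑ z, O z * Real.log (O z / iidLaw Q n z) := by
  classical
  have hN : (0 : ℝ) < Fintype.card M := by exact_mod_cast Fintype.card_pos
  have hJpos : ∀ m y, V m y ≠ 0 → ∀ i, 0 < J (x i m, y i) := by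
    intro m y hy i
    refine (hJ0 _).lt_of_ne' fun h0 => hy ?_
    have h := hJ fun a z => if a = x i m ∧ z = y i then 1 else 0
    have hr : ∑ a, ∑ z, J (a, z) * (if a = x i m ∧ z = y i then (1 : ℝ) else 0) = 0 := by
      refine Finset.sum_eq_zero fun a _ => Finset.sum_eq_zero fun z _ => ?_
      split_ifs with hc
      · rw [hc.1, hc.2, h0, zero_mul]
      · rw [mul_zero]
    rw [hr, mul_zero] at h
    have hnn : ∀ m' (y' : Fin n → Z), 0 ≤ V m' y' * ∑ j, (if x j m' = x i m ∧ y' j = y i then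
        (1 : ℝ) else 0) := fun m' y' => mul_nonneg (hV0 _ _)
      (Finset.sum_nonneg fun j _ => by split_ifs <;> norm_num)
    have h2 := (Finset.sum_eq_zero_iff_of_nonneg fun m' _ =>
      Finset.sum_nonneg fun y' _ => hnn m' y').1
      ((mul_eq_zero.1 h).resolve_left (inv_ne_zero hN.ne')) m (Finset.mem_univ _)
    have h3 := (Finset.sum_eq_zero_iff_of_nonneg fun y' _ => hnn m y').1 h2 y (Finset.mem_univ _)
    refine (mul_eq_zero.1 h3).resolve_right fun h4 => ?_
    have h5 := (Finset.sum_eq_zero_iff_of_nonneg fun j _ => by split_ifs <;> norm_num).1 h4 i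
      (Finset.mem_univ _)
    simp at h5
  have hQpos : ∀ m y, V m y ≠ 0 → ∀ i, 0 < Q (y i) := by
    intro m y hy i
    refine (hQ0 _).lt_of_ne' fun h0 => hy (hVQ m y ?_)
    exact Finset.prod_eq_zero (Finset.mem_univ i) h0
  have hJX : ∀ a z, 0 < J (a, z) → 0 < ∑ z', J (a, z') := fun a z h =>
    h.trans_le (Finset.single_le_sum (f := fun z => J (a, z)) (fun _ _ => hJ0 _)
      (Finset.mem_univ z))
  have hgibbs : ∀ m, ∑ y, V m y *
      ∑ i, Real.log (J (x i m, y i) / ((∑ z', J (x i m, z')) * Q (y i)))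
      ≤ ∑ y, V m y * Real.log (V m y / iidLaw Q n y) := by
    intro m
    -- The product of the conditional laws of `J` along the word of `m`. Gibbs' inequality against
    -- it does not need `V m` to be a product, which matters when `m₂` is averaged out. Rows of zero
    -- mass are why its total is only bounded by one.
    set L : (Fin n → Z) → ℝ := fun y => ∏ i, J (x i m, y i) / ∑ z', J (x i m, z') with hL
    have hL0 : ∀ y, 0 ≤ L y := fun y => Finset.prod_nonneg fun i _ =>
      div_nonneg (hJ0 _) (Finset.sum_nonneg fun _ _ => hJ0 _)
    have hLpos : ∀ y, V m y ≠ 0 → 0 < L y := fun y hy => Finset.prod_pos fun i _ =>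
      div_pos (hJpos m y hy i) (hJX _ _ (hJpos m y hy i))
    have hL1 : ∑ y, L y ≤ ∑ y, V m y := by
      simp only [hL]
      rw [hV1, sum_prod_word (fun i z => J (x i m, z) / ∑ z', J (x i m, z'))]
      refine Finset.prod_le_one (fun i _ => Finset.sum_nonneg fun _ _ =>
        div_nonneg (hJ0 _) (Finset.sum_nonneg fun _ _ => hJ0 _)) fun i _ => ?_
      rw [← Finset.sum_div]
      exact div_self_le_one _
    have h := sum_mul_log_div_nonneg (hV0 m) hL0 hL1
      (fun y hy => by_contra fun hne => (hLpos y hne).ne' hy)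
    rw [← sub_nonneg, ← Finset.sum_sub_distrib]
    refine h.trans_eq (Finset.sum_congr rfl fun y _ => ?_)
    by_cases hy : V m y = 0
    · simp [hy]
    have hq : 0 < iidLaw Q n y := Finset.prod_pos fun i _ => hQpos m y hy i
    have hsum : ∑ i, Real.log (J (x i m, y i) / ((∑ z', J (x i m, z')) * Q (y i)))
        = Real.log (L y / iidLaw Q n y) := by
      rw [hL, iidLaw, ← Finset.prod_div_distrib, Real.log_prod]
      · simp only [div_div]
      · intro i _
        exact (div_pos (div_pos (hJpos m y hy i) (hJX _ _ (hJpos m y hy i)))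
          (hQpos m y hy i)).ne'
    rw [hsum, Real.log_div hy hq.ne', Real.log_div hy (hLpos y hy).ne',
      Real.log_div (hLpos y hy).ne' hq.ne']
    ring
  -- The overall law contains `V m` with weight `1/|M|`, so passing from `V m` to `O` costs at most
  -- `log |M|`.
  have hcount : ∀ m y, V m y * Real.log (V m y / iidLaw Q n y)
      ≤ V m y * (Real.log (Fintype.card M) + Real.log (O y / iidLaw Q n y)) := by
    intro m y
    by_cases hy : V m y = 0
    · simp [hy]
    have hv : 0 < V m y := (hV0 m y).lt_of_ne' hy
    have hq : 0 < iidLaw Q n y := Finset.prod_pos fun i _ => hQpos m y hy i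
    have hle : V m y ≤ Fintype.card M * O y := by
      rw [hO, mul_inv_cancel_left₀ hN.ne']
      exact Finset.single_le_sum (f := fun m => V m y) (fun _ _ => hV0 _ _) (Finset.mem_univ m)
    have hOpos : 0 < O y := pos_of_mul_pos_right (hv.trans_le hle) hN.le
    refine mul_le_mul_of_nonneg_left ?_ hv.le
    rw [← Real.log_mul hN.ne' (div_pos hOpos hq).ne', ← mul_div_assoc]
    exact Real.log_le_log (div_pos hv hq) (by gcongr)
  rw [← hJ fun a z => Real.log (J (a, z) / ((∑ z', J (a, z')) * Q z))]
  calc _ ≤ (Fintype.card M : ℝ)⁻¹ * ∑ m, ∑ y, V m y * (Real.log (Fintype.card M) +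
        Real.log (O y / iidLaw Q n y)) := by
        refine mul_le_mul_of_nonneg_left (Finset.sum_le_sum fun m _ => ?_) (inv_nonneg.2 hN.le)
        exact (hgibbs m).trans (Finset.sum_le_sum fun y _ => hcount m y)
    _ = _ := by
        simp only [mul_add, Finset.sum_add_distrib, ← Finset.sum_mul, hV1]
        rw [Finset.sum_comm]
        simp only [hO, Finset.mul_sum, Finset.sum_mul]
        rw [Finset.sum_const, Finset.card_univ, nsmul_eq_mul, one_mul,
          mul_inv_cancel_left₀ hN.ne']
        simp only [mul_assoc]

/-- Replacing the output marginal by another law increases mutual information (in nats). -/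
lemma log_two_mul_mutualInfo_le {X : Type*} [Fintype X] {J : X × Z → ℝ} (hJ0 : ∀ p, 0 ≤ J p)
    {Q : Z → ℝ} (hQ0 : ∀ z, 0 ≤ Q z) (hsum : ∑ z, Q z ≤ ∑ z, ∑ a, J (a, z))
    (hJQ : ∀ a z, Q z = 0 → J (a, z) = 0) :
    Real.log 2 * mutualInfo J
      ≤ ∑ a, ∑ z, J (a, z) * Real.log (J (a, z) / ((∑ z', J (a, z')) * Q z)) := by
  have hl2 : Real.log 2 ≠ 0 := (Real.log_pos (by norm_num)).ne'
  -- The gap between the two sides is the divergence of the output marginal of `J` from `Q`.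
  have h := sum_mul_log_div_nonneg (P := fun z => ∑ a, J (a, z))
    (fun z => Finset.sum_nonneg fun a _ => hJ0 _) hQ0 hsum
    (fun z hz => Finset.sum_eq_zero fun a _ => hJQ a z hz)
  have e : ∑ z, (∑ a, J (a, z)) * Real.log ((∑ a, J (a, z)) / Q z)
      = ∑ a, ∑ z, J (a, z) * Real.log ((∑ a, J (a, z)) / Q z) := by
    rw [Finset.sum_comm]
    simp only [Finset.sum_mul]
  rw [e] at h
  rw [mutualInfo, ← sub_nonneg, Finset.mul_sum, ← Finset.sum_sub_distrib]
  refine h.trans_eq (Finset.sum_congr rfl fun a _ => ?_)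
  rw [Finset.mul_sum, ← Finset.sum_sub_distrib]
  refine Finset.sum_congr rfl fun z _ => ?_
  by_cases h0 : J (a, z) = 0
  · simp [h0]
  have hp : 0 < J (a, z) := (hJ0 _).lt_of_ne' h0
  have hx : 0 < ∑ z', J (a, z') := hp.trans_le (Finset.single_le_sum
    (f := fun z => J (a, z)) (fun _ _ => hJ0 _) (Finset.mem_univ z))
  have hz : 0 < ∑ a', J (a', z) := hp.trans_le (Finset.single_le_sum
    (f := fun a => J (a, z)) (fun _ _ => hJ0 _) (Finset.mem_univ a))
  have hq : Q z ≠ 0 := fun h' => h0 (hJQ a z h')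
  rw [Real.logb, Real.log_div hz.ne' hq, Real.log_div h0 (mul_ne_zero hx.ne' hq),
    Real.log_div h0 (mul_ne_zero hx.ne' hz.ne'), Real.log_mul hx.ne' hq,
    Real.log_mul hx.ne' hz.ne']
  field_simp
  ring

/-! ### Time-averaged letters and bounds for a single code -/

/-- The time-averaged law of the input letters of a code. -/
def DegradedCode.averageInput {N₁ N₂ n : ℕ} (c : DegradedCode X₁ X₂ N₁ N₂ n) : X₁ × X₂ → ℝ :=
  open Classical in
  fun x => ((n : ℝ) * (N₁ * N₂))⁻¹ *
    ∑ m₁, ∑ m₂, ∑ i, if (c.enc₁ i m₁, c.enc₂ i m₁ m₂) = x then 1 else 0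

section Average

variable [Fintype X₁] [Fintype X₂] {N₁ N₂ n : ℕ} (c : DegradedCode X₁ X₂ N₁ N₂ n)

lemma DegradedCode.sum_averageInput_mul (hn : 0 < n) (g : X₁ × X₂ → ℝ) :
    n * ∑ x, c.averageInput x * g x
      = ((N₁ : ℝ) * N₂)⁻¹ * ∑ m₁, ∑ m₂, ∑ i, g (c.enc₁ i m₁, c.enc₂ i m₁ m₂) := by
  classical
  have hn' : (n : ℝ) ≠ 0 := by positivity
  have h : ∑ x, c.averageInput x * g x = ((n : ℝ) * (N₁ * N₂))⁻¹ *
      ∑ m₁, ∑ m₂, ∑ i, g (c.enc₁ i m₁, c.enc₂ i m₁ m₂) := by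
    simp only [DegradedCode.averageInput, mul_assoc]
    rw [← Finset.mul_sum]
    congr 1
    simp only [Finset.sum_mul]
    rw [Finset.sum_comm]
    refine Finset.sum_congr rfl fun m₁ _ => ?_
    rw [Finset.sum_comm]
    refine Finset.sum_congr rfl fun m₂ _ => ?_
    rw [Finset.sum_comm]
    refine Finset.sum_congr rfl fun i _ => ?_
    simp
  rw [h, mul_inv, ← mul_assoc, mul_inv_cancel_left₀ hn']

lemma DegradedCode.averageInput_mem (hn : 0 < n) (hN₁ : 0 < N₁) (hN₂ : 0 < N₂) :
    c.averageInput ∈ stdSimplex ℝ (X₁ × X₂) := by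
  constructor
  · intro x
    exact mul_nonneg (by positivity) (Finset.sum_nonneg fun _ _ => Finset.sum_nonneg fun _ _ =>
      Finset.sum_nonneg fun _ _ => by split_ifs <;> norm_num)
  · have h := c.sum_averageInput_mul hn fun _ => 1
    simp only [mul_one, Finset.sum_const, Finset.card_univ, Fintype.card_fin, nsmul_eq_mul] at h
    have hn' : (n : ℝ) ≠ 0 := by positivity
    have h₁ : (N₁ : ℝ) ≠ 0 := by positivity
    have h₂ : (N₂ : ℝ) ≠ 0 := by positivity
    refine mul_left_cancel₀ hn' (h.trans ?_)
    field_simp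

/-- Given the messages, the `i`-th output letter has law `W` at the `i`-th inputs. Choosing which
arguments `G` depends on gives hypothesis `hJ` of `single_letter_bound` in each of its three uses.
-/
lemma DegradedCode.average_letters (hW : IsChannel W) (hn : 0 < n) (G : X₁ → X₂ → Z → ℝ) :
    ((N₁ : ℝ) * N₂)⁻¹ * ∑ m₁, ∑ m₂, ∑ z : Fin n → Z,
        (∏ i, W (c.enc₁ i m₁) (c.enc₂ i m₁ m₂) (z i)) *
          ∑ i, G (c.enc₁ i m₁) (c.enc₂ i m₁ m₂) (z i)
      = n * ∑ x, ∑ z, lawInputsOutput c.averageInput W (x, z) * G x.1 x.2 z := by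
  simp only [lawInputsOutput, mul_assoc]
  simp only [← Finset.mul_sum]
  rw [c.sum_averageInput_mul hn fun x => ∑ z, W x.1 x.2 z * G x.1 x.2 z]
  congr 1
  refine Finset.sum_congr rfl fun m₁ _ => Finset.sum_congr rfl fun m₂ _ => ?_
  simp only [Finset.mul_sum]
  rw [Finset.sum_comm]
  refine Finset.sum_congr rfl fun i _ => ?_
  exact sum_prod_word_mul (fun i => W (c.enc₁ i m₁) (c.enc₂ i m₁ m₂)) (fun i => (hW _ _).2) i
    fun z => G (c.enc₁ i m₁) (c.enc₂ i m₁ m₂) z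

end Average

lemma DegradedCode.word_eq_zero {N₁ N₂ n : ℕ} (c : DegradedCode X₁ X₂ N₁ N₂ n)
    (hW : IsChannel W) {z : Fin n → Z} (h : c.inducedLaw W z = 0)
    (m₁ : Fin N₁) (m₂ : Fin N₂) : ∏ i, W (c.enc₁ i m₁) (c.enc₂ i m₁ m₂) (z i) = 0 := by
  have hN₁ : (N₁ : ℝ) ≠ 0 := by exact_mod_cast m₁.pos.ne'
  have hN₂ : (N₂ : ℝ) ≠ 0 := by exact_mod_cast m₂.pos.ne'
  have h0 : ∀ m₁ m₂, 0 ≤ ∏ i, W (c.enc₁ i m₁) (c.enc₂ i m₁ m₂) (z i) := fun _ _ =>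
    Finset.prod_nonneg fun _ _ => (hW _ _).1 _
  have h1 := (mul_eq_zero.1 h).resolve_left (inv_ne_zero (mul_ne_zero hN₁ hN₂))
  have h2 := (Finset.sum_eq_zero_iff_of_nonneg fun _ _ => Finset.sum_nonneg fun _ _ => h0 _ _).1
    h1 m₁ (Finset.mem_univ _)
  exact (Finset.sum_eq_zero_iff_of_nonneg fun _ _ => h0 _ _).1 h2 m₂ (Finset.mem_univ _)

section Bounds

variable [Fintype X₁] [Fintype X₂] {N₁ N₂ n : ℕ} (c : DegradedCode X₁ X₂ N₁ N₂ n)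

lemma lawInputsOutput_nonneg (hW : IsChannel W) {P : X₁ × X₂ → ℝ}
    (hP : P ∈ stdSimplex ℝ (X₁ × X₂)) (p : (X₁ × X₂) × Z) : 0 ≤ lawInputsOutput P W p :=
  mul_nonneg (hP.1 _) ((hW _ _).1 _)

lemma lawFirstOutput_nonneg (hW : IsChannel W) {P : X₁ × X₂ → ℝ}
    (hP : P ∈ stdSimplex ℝ (X₁ × X₂)) (p : X₁ × Z) : 0 ≤ lawFirstOutput P W p :=
  Finset.sum_nonneg fun _ _ => lawInputsOutput_nonneg hW hP _

lemma lawOutput_nonneg (hW : IsChannel W) {P : X₁ × X₂ → ℝ}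
    (hP : P ∈ stdSimplex ℝ (X₁ × X₂)) (z : Z) : 0 ≤ lawOutput P W z :=
  Finset.sum_nonneg fun _ _ => lawInputsOutput_nonneg hW hP _

lemma sum_lawFirstOutput {Y : Type*} {W : X₁ → X₂ → Y → ℝ} (P : X₁ × X₂ → ℝ) (z : Y) :
    ∑ a, lawFirstOutput P W (a, z) = lawOutput P W z := by
  simp only [lawFirstOutput, lawOutput]
  rw [Fintype.sum_prod_type]

lemma sum_lawOutput (hW : IsChannel W) {P : X₁ × X₂ → ℝ} (hP : P ∈ stdSimplex ℝ (X₁ × X₂)) :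
    ∑ z, lawOutput P W z = 1 := by
  simp only [lawOutput, lawInputsOutput]
  rw [Finset.sum_comm]
  simp [← Finset.mul_sum, (hW _ _).2, hP.2]

/-- `single_letter_bound` with one message and one input letter, so that `log |M| = 0`. Divergence
is weakened to Hellinger distance, which is continuous even where `Q` vanishes and so survives a
limit. -/
lemma DegradedCode.lawOutput_bound (hW : IsChannel W) {Q : Z → ℝ} (hQ : Q ∈ stdSimplex ℝ Z)
    (hn : 0 < n) (hN₁ : 0 < N₁) (hN₂ : 0 < N₂)
    (habs : ∀ z, iidLaw Q n z = 0 → c.inducedLaw W z = 0) :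
    (∀ z, Q z = 0 → lawOutput c.averageInput W z = 0) ∧
    n * ∑ z, (√(lawOutput c.averageInput W z) - √(Q z)) ^ 2
      ≤ ∑ z, c.inducedLaw W z * Real.log (c.inducedLaw W z / iidLaw Q n z) := by
  have hP := c.averageInput_mem hn hN₁ hN₂
  have hJ : ∀ h : Unit → Z → ℝ, (Fintype.card Unit : ℝ)⁻¹ * ∑ _m : Unit, ∑ z,
      c.inducedLaw W z * ∑ i : Fin n, h () (z i)
      = n * ∑ a : Unit, ∑ z, lawOutput c.averageInput W (a, z).2 * h a z := by
    intro h
    have h1 := c.average_letters hW hn fun _ _ z => h () z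
    rw [Finset.sum_comm (s := (Finset.univ : Finset (X₁ × X₂)))] at h1
    simp only [← Finset.sum_mul] at h1
    simp only [Fintype.card_unit, Nat.cast_one, inv_one, one_mul, Finset.univ_unique,
      Finset.sum_singleton]
    refine Eq.trans ?_ h1
    simp only [DegradedCode.inducedLaw, mul_assoc]
    rw [← Finset.mul_sum]
    congr 1
    simp only [Finset.sum_mul]
    rw [Finset.sum_comm]
    refine Finset.sum_congr rfl fun m₁ _ => ?_
    rw [Finset.sum_comm]
  have hJ0 : ∀ p : Unit × Z, 0 ≤ lawOutput c.averageInput W p.2 := fun p =>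
    lawOutput_nonneg hW hP _
  have hzero := eq_zero_of_average (M := Unit) (X := Unit) hn (x := fun _ _ => ())
    (V := fun _ => c.inducedLaw W) (J := fun p => lawOutput c.averageInput W p.2)
    (fun _ => habs) hJ0 hJ ()
  refine ⟨hzero, ?_⟩
  have hb := single_letter_bound (M := Unit) (X := Unit) (x := fun _ _ => ())
    (V := fun _ => c.inducedLaw W) (J := fun p => lawOutput c.averageInput W p.2)
    (fun _ => c.inducedLaw_nonneg hW) (fun _ => c.sum_inducedLaw hW hN₁ hN₂) hQ.1
    (O := c.inducedLaw W) (fun z => by simp) (fun _ => habs) hJ0 hJ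
  simp only [Finset.univ_unique, Finset.sum_singleton, sum_lawOutput hW hP, one_mul,
    Fintype.card_unit, Nat.cast_one, Real.log_one, zero_add] at hb
  refine le_trans ?_ hb
  exact mul_le_mul_of_nonneg_left (hellinger_le_sum_mul_log (lawOutput_nonneg hW hP) hQ.1
    (sum_lawOutput hW hP) hQ.2 hzero) n.cast_nonneg

/-- Encoder 1 sees only `m₁`; averaging over `m₂` makes Encoder 2 part of a channel, with memory in
general, from words of Encoder 1 to outputs. -/
lemma DegradedCode.mutualInfo_first_bound (hW : IsChannel W) {Q : Z → ℝ}
    (hQ : Q ∈ stdSimplex ℝ Z) (hn : 0 < n) (hN₁ : 0 < N₁) (hN₂ : 0 < N₂)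
    (habs : ∀ z, iidLaw Q n z = 0 → c.inducedLaw W z = 0) :
    n * (Real.log 2 * mutualInfo (lawFirstOutput c.averageInput W))
      ≤ Real.log N₁ + ∑ z, c.inducedLaw W z * Real.log (c.inducedLaw W z / iidLaw Q n z) := by
  have : Nonempty (Fin N₁) := ⟨⟨0, hN₁⟩⟩
  have hN₂' : (N₂ : ℝ) ≠ 0 := by positivity
  have hP := c.averageInput_mem hn hN₁ hN₂
  have hzero := (c.lawOutput_bound hW hQ hn hN₁ hN₂ habs).1
  have hJ0 := lawFirstOutput_nonneg (W := W) hW hP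
  have hb := single_letter_bound (M := Fin N₁) (X := X₁) (x := c.enc₁)
    (V := fun m₁ z => (N₂ : ℝ)⁻¹ * ∑ m₂, ∏ i, W (c.enc₁ i m₁) (c.enc₂ i m₁ m₂) (z i))
    (J := lawFirstOutput c.averageInput W)
    (fun _ _ => mul_nonneg (by positivity) (Finset.sum_nonneg fun _ _ =>
      Finset.prod_nonneg fun _ _ => (hW _ _).1 _))
    (fun m₁ => by
      rw [← Finset.mul_sum, Finset.sum_comm]
      have h : ∀ m₂, ∑ z : Fin n → Z, ∏ i, W (c.enc₁ i m₁) (c.enc₂ i m₁ m₂) (z i) = 1 := by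
        intro m₂
        rw [sum_prod_word (fun i => W (c.enc₁ i m₁) (c.enc₂ i m₁ m₂))]
        exact Finset.prod_eq_one fun i _ => (hW _ _).2
      simp [h, hN₂'])
    hQ.1 (O := c.inducedLaw W)
    (fun z => by
      rw [DegradedCode.inducedLaw, Fintype.card_fin, ← Finset.mul_sum, mul_inv, mul_assoc])
    (fun m₁ z hz => by
      simp only [c.word_eq_zero hW (habs z hz), Finset.sum_const_zero, mul_zero])
    hJ0
    (fun h => by
      have h1 := c.average_letters hW hn fun a _ z => h a z
      have e : ∑ x : X₁ × X₂, ∑ z, lawInputsOutput c.averageInput W (x, z) * h x.1 z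
          = ∑ a, ∑ z, lawFirstOutput c.averageInput W (a, z) * h a z := by
        rw [Fintype.sum_prod_type]
        refine Finset.sum_congr rfl fun a _ => ?_
        rw [Finset.sum_comm]
        simp only [lawFirstOutput, Finset.sum_mul]
      rw [← e]
      refine Eq.trans ?_ h1
      rw [Fintype.card_fin, mul_inv, mul_assoc, Finset.mul_sum (a := (N₂ : ℝ)⁻¹)]
      congr 1
      refine Finset.sum_congr rfl fun m₁ _ => ?_
      simp only [mul_assoc]
      rw [← Finset.mul_sum]
      congr 1
      simp only [Finset.sum_mul]
      rw [Finset.sum_comm])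
  rw [Fintype.card_fin] at hb
  refine le_trans ?_ hb
  gcongr
  refine log_two_mul_mutualInfo_le hJ0 hQ.1 ?_ fun a z hz => ?_
  · simp only [sum_lawFirstOutput, sum_lawOutput hW hP, hQ.2, le_refl]
  · have h := hzero z hz
    rw [← sum_lawFirstOutput] at h
    exact (Finset.sum_eq_zero_iff_of_nonneg fun a _ => hJ0 (a, z)).1 h a (Finset.mem_univ a)

lemma DegradedCode.mutualInfo_pair_bound (hW : IsChannel W) {Q : Z → ℝ}
    (hQ : Q ∈ stdSimplex ℝ Z) (hn : 0 < n) (hN₁ : 0 < N₁) (hN₂ : 0 < N₂)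
    (habs : ∀ z, iidLaw Q n z = 0 → c.inducedLaw W z = 0) :
    n * (Real.log 2 * mutualInfo (lawInputsOutput c.averageInput W))
      ≤ Real.log (N₁ * N₂)
        + ∑ z, c.inducedLaw W z * Real.log (c.inducedLaw W z / iidLaw Q n z) := by
  have : Nonempty (Fin N₁ × Fin N₂) := ⟨⟨0, hN₁⟩, ⟨0, hN₂⟩⟩
  have hP := c.averageInput_mem hn hN₁ hN₂
  have hzero := (c.lawOutput_bound hW hQ hn hN₁ hN₂ habs).1
  have hJ0 := lawInputsOutput_nonneg (W := W) hW hP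
  have hb := single_letter_bound (M := Fin N₁ × Fin N₂) (X := X₁ × X₂)
    (x := fun i m => (c.enc₁ i m.1, c.enc₂ i m.1 m.2))
    (V := fun m z => ∏ i, W (c.enc₁ i m.1) (c.enc₂ i m.1 m.2) (z i))
    (J := lawInputsOutput c.averageInput W)
    (fun _ _ => Finset.prod_nonneg fun _ _ => (hW _ _).1 _)
    (fun m => by
      rw [sum_prod_word (fun i => W (c.enc₁ i m.1) (c.enc₂ i m.1 m.2))]
      exact Finset.prod_eq_one fun i _ => (hW _ _).2)
    hQ.1 (O := c.inducedLaw W)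
    (fun z => by
      rw [DegradedCode.inducedLaw, Fintype.card_prod, Fintype.card_fin, Fintype.card_fin,
        Fintype.sum_prod_type, Nat.cast_mul])
    (fun m z hz => c.word_eq_zero hW (habs z hz) _ _)
    hJ0
    (fun h => by
      rw [← c.average_letters hW hn fun a b z => h (a, b) z, Fintype.card_prod, Fintype.card_fin,
        Fintype.card_fin, Fintype.sum_prod_type, Nat.cast_mul])
  rw [Fintype.card_prod, Fintype.card_fin, Fintype.card_fin, Nat.cast_mul] at hb
  refine le_trans ?_ hb
  gcongr
  refine log_two_mul_mutualInfo_le hJ0 hQ.1 ?_ fun a z hz => ?_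
  · exact (hQ.2.trans (sum_lawOutput hW hP).symm).le
  · exact (Finset.sum_eq_zero_iff_of_nonneg fun x _ => hJ0 (x, z)).1 (hzero z hz) a
      (Finset.mem_univ a)

end Bounds

lemma log_numMessages_le {R : ℝ} (hR : 0 ≤ R) (n : ℕ) :
    Real.log (numMessages R n) ≤ n * R * Real.log 2 := by
  have h0 : (0 : ℝ) < numMessages R n := by exact_mod_cast numMessages_pos hR n
  rw [← Real.log_rpow two_pos]
  exact Real.log_le_log h0 (Nat.floor_le (by positivity))

/-- An achievable pair satisfies the single-letter constraints up to any `ε`. -/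
lemma IsAchievable.exists_law [Fintype X₁] [Fintype X₂] (hW : IsChannel W) {Q : Z → ℝ}
    (hQ : Q ∈ stdSimplex ℝ Z) {R : ℝ × ℝ} (hR : IsAchievable W Q R) {ε : ℝ} (hε : 0 < ε) :
    ∃ P ∈ stdSimplex ℝ (X₁ × X₂), ∑ z, (√(lawOutput P W z) - √(Q z)) ^ 2 ≤ ε ∧
      mutualInfo (lawFirstOutput P W) ≤ R.1 + ε ∧
      mutualInfo (lawInputsOutput P W) ≤ R.1 + R.2 + ε := by
  obtain ⟨hR₁, hR₂, c, hc⟩ := hR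
  have hl2 : 0 < Real.log 2 := Real.log_pos (by norm_num)
  have hl2' : Real.log 2 ≤ 1 := by linarith [Real.log_le_sub_one_of_pos (x := 2) two_pos]
  -- Divergence below one bit at a single long block suffices: its contribution after division by
  -- `n` is below `ε`.
  obtain ⟨n, hn1, hnε⟩ : ∃ n : ℕ, relEntropy ((c n).inducedLaw W) (iidLaw Q n) < 1 ∧
      1 / ε < n :=
    ((hc.eventually (eventually_lt_nhds zero_lt_one)).and
      (tendsto_natCast_atTop_atTop.eventually (Filter.eventually_gt_atTop (1 / ε)))).exists
  have hn0 : (0 : ℝ) < n := (by positivity : (0 : ℝ) < 1 / ε).trans hnε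
  have hn : 0 < n := by exact_mod_cast hn0
  have habs : ∀ z, iidLaw Q n z = 0 → (c n).inducedLaw W z = 0 := by
    intro z hz
    by_contra hne
    rw [relEntropy, if_pos ⟨z, hne, hz⟩] at hn1
    exact not_top_lt hn1
  rw [relEntropy_of_forall habs, sum_mul_logb, ← EReal.coe_one, EReal.coe_lt_coe_iff,
    div_lt_one hl2] at hn1
  have hN₁ := numMessages_pos hR₁ n
  have hN₂ := numMessages_pos hR₂ n
  have hN₁' : (0 : ℝ) < numMessages R.1 n := by exact_mod_cast hN₁
  have hN₂' : (0 : ℝ) < numMessages R.2 n := by exact_mod_cast hN₂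
  have hnε' : 1 ≤ n * ε := by
    rw [div_lt_iff₀ hε] at hnε; exact hnε.le
  refine ⟨(c n).averageInput, (c n).averageInput_mem hn hN₁ hN₂, ?_, ?_, ?_⟩
  · have h := ((c n).lawOutput_bound hW hQ hn hN₁ hN₂ habs).2
    refine le_of_mul_le_mul_left ?_ hn0
    linarith
  · have h := (c n).mutualInfo_first_bound hW hQ hn hN₁ hN₂ habs
    have h' := log_numMessages_le hR₁ n
    refine le_of_mul_le_mul_left ?_ (mul_pos hn0 hl2)
    have := mul_le_mul_of_nonneg_right hnε' hl2.le
    linarith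
  · have h := (c n).mutualInfo_pair_bound hW hQ hn hN₁ hN₂ habs
    rw [Real.log_mul hN₁'.ne' hN₂'.ne'] at h
    have h₁ := log_numMessages_le hR₁ n
    have h₂ := log_numMessages_le hR₂ n
    refine le_of_mul_le_mul_left ?_ (mul_pos hn0 hl2)
    have := mul_le_mul_of_nonneg_right hnε' hl2.le
    linarith

/-! ### Continuity and compactness -/

/-- Mutual information as a combination of entropies. -/
lemma mutualInfo_eq_negMulLog {α β : Type*} [Fintype α] [Fintype β] {P : α × β → ℝ}
    (hP : ∀ p, 0 ≤ P p) :
    mutualInfo P = (∑ a, Real.negMulLog (∑ b, P (a, b)) + ∑ b, Real.negMulLog (∑ a, P (a, b))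
      - ∑ a, ∑ b, Real.negMulLog (P (a, b))) / Real.log 2 := by
  have e₁ : ∑ a, Real.negMulLog (∑ b, P (a, b))
      = ∑ a, ∑ b, -(P (a, b) * Real.log (∑ b', P (a, b'))) :=
    Finset.sum_congr rfl fun a _ => by
      rw [Real.negMulLog, Finset.sum_neg_distrib, ← Finset.sum_mul, neg_mul]
  have e₂ : ∑ b, Real.negMulLog (∑ a, P (a, b))
      = ∑ a, ∑ b, -(P (a, b) * Real.log (∑ a', P (a', b))) := by
    rw [Finset.sum_comm]
    exact Finset.sum_congr rfl fun b _ => by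
      rw [Real.negMulLog, Finset.sum_neg_distrib, ← Finset.sum_mul, neg_mul]
  rw [e₁, e₂, mutualInfo, ← Finset.sum_add_distrib, ← Finset.sum_sub_distrib, Finset.sum_div]
  refine Finset.sum_congr rfl fun a _ => ?_
  rw [← Finset.sum_add_distrib, ← Finset.sum_sub_distrib, Finset.sum_div]
  refine Finset.sum_congr rfl fun b _ => ?_
  by_cases h : P (a, b) = 0
  · simp [h]
  have hp : 0 < P (a, b) := (hP _).lt_of_ne' h
  have hx : 0 < ∑ b', P (a, b') := hp.trans_le (Finset.single_le_sum
    (f := fun b => P (a, b)) (fun _ _ => hP _) (Finset.mem_univ b))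
  have hz : 0 < ∑ a', P (a', b) := hp.trans_le (Finset.single_le_sum
    (f := fun a => P (a, b)) (fun _ _ => hP _) (Finset.mem_univ a))
  rw [Real.logb, Real.log_div h (mul_pos hx hz).ne', Real.log_mul hx.ne' hz.ne', Real.negMulLog]
  ring

/-- The entropy form has no singularity at vanishing probabilities, `Real.negMulLog` being
continuous everywhere; nonnegativity on `S` is needed to pass to that form. -/
lemma continuousOn_mutualInfo {E α β : Type*} [TopologicalSpace E] [Fintype α] [Fintype β]
    {T : E → α × β → ℝ} {S : Set E} (hT : Continuous T) (hS : ∀ x ∈ S, ∀ p, 0 ≤ T x p) :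
    ContinuousOn (fun x => mutualInfo (T x)) S := by
  refine ContinuousOn.congr (Continuous.continuousOn ?_)
    fun x hx => mutualInfo_eq_negMulLog (hS x hx)
  have h : ∀ p, Continuous fun x => T x p := fun p => (continuous_apply p).comp hT
  have hN := Real.continuous_negMulLog
  refine Continuous.div_const (Continuous.sub (Continuous.add ?_ ?_) ?_) _
  · exact continuous_finsetSum _ fun a _ => hN.comp (continuous_finsetSum _ fun b _ => h _)
  · exact continuous_finsetSum _ fun b _ => hN.comp (continuous_finsetSum _ fun a _ => h _)
  · exact continuous_finsetSum _ fun a _ => continuous_finsetSum _ fun b _ => hN.comp (h _)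

/-- Approximate solutions of the single-letter constraints accumulate at an exact one. -/
lemma exists_law_of_forall_approx [Fintype X₁] [Fintype X₂] (hW : IsChannel W) {Q : Z → ℝ}
    (hQ : Q ∈ stdSimplex ℝ Z) {A B : ℝ}
    (h : ∀ ε : ℝ, 0 < ε → ∃ P ∈ stdSimplex ℝ (X₁ × X₂),
      ∑ z, (√(lawOutput P W z) - √(Q z)) ^ 2 ≤ ε ∧
      mutualInfo (lawFirstOutput P W) ≤ A + ε ∧ mutualInfo (lawInputsOutput P W) ≤ B + ε) :
    ∃ P ∈ stdSimplex ℝ (X₁ × X₂), lawOutput P W = Q ∧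
      mutualInfo (lawFirstOutput P W) ≤ A ∧ mutualInfo (lawInputsOutput P W) ≤ B := by
  have hpair : Continuous fun P : X₁ × X₂ → ℝ => lawInputsOutput P W :=
    continuous_pi fun p => (continuous_apply p.1).mul continuous_const
  have hfirst : Continuous fun P : X₁ × X₂ → ℝ => lawFirstOutput P W :=
    continuous_pi fun p => continuous_finsetSum _ fun b _ =>
      (continuous_apply ((p.1, b), p.2)).comp hpair
  have hout : Continuous fun P : X₁ × X₂ → ℝ => lawOutput P W :=
    continuous_pi fun z => continuous_finsetSum _ fun x _ =>
      (continuous_apply (x, z)).comp hpair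
  have hH : Continuous fun P : X₁ × X₂ → ℝ => ∑ z, (√(lawOutput P W z) - √(Q z)) ^ 2 :=
    continuous_finsetSum _ fun z _ =>
      ((((continuous_apply z).comp hout).sqrt).sub continuous_const).pow 2
  choose P hP h₀ h₁ h₂ using fun k : ℕ => h (1 / ((k : ℝ) + 1)) (by positivity)
  obtain ⟨P', hP', φ, hφ, hlim⟩ := (isCompact_stdSimplex ℝ (X₁ × X₂)).tendsto_subseq hP
  have hlim' : Filter.Tendsto (P ∘ φ) Filter.atTop (nhdsWithin P' (stdSimplex ℝ (X₁ × X₂))) :=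
    tendsto_nhdsWithin_iff.2 ⟨hlim, Filter.Eventually.of_forall fun k => hP _⟩
  have hε : Filter.Tendsto (fun k => 1 / ((φ k : ℝ) + 1)) Filter.atTop (nhds 0) :=
    tendsto_one_div_add_atTop_nhds_zero_nat.comp hφ.tendsto_atTop
  have g₀ := le_of_tendsto_of_tendsto' ((hH.tendsto P').comp hlim) hε fun k => h₀ (φ k)
  have g₁ := le_of_tendsto_of_tendsto'
    ((continuousOn_mutualInfo hfirst (S := stdSimplex ℝ (X₁ × X₂))
      (fun P hP => lawFirstOutput_nonneg hW hP) P' hP').tendsto.comp hlim')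
    (hε.const_add A) fun k => h₁ (φ k)
  have g₂ := le_of_tendsto_of_tendsto'
    ((continuousOn_mutualInfo hpair (S := stdSimplex ℝ (X₁ × X₂))
      (fun P hP => lawInputsOutput_nonneg hW hP) P' hP').tendsto.comp hlim')
    (hε.const_add B) fun k => h₂ (φ k)
  rw [add_zero] at g₁ g₂
  refine ⟨P', hP', funext fun z => ?_, g₁, g₂⟩
  have hz := (Finset.sum_eq_zero_iff_of_nonneg fun z _ => sq_nonneg _).1
    (le_antisymm g₀ (Finset.sum_nonneg fun z _ => sq_nonneg _)) z (Finset.mem_univ z)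
  exact (Real.sqrt_inj (lawOutput_nonneg hW hP' z) (hQ.1 z)).1
    (sub_eq_zero.1 (pow_eq_zero_iff two_ne_zero |>.1 hz))

end MACResolvability

end

/-! ### The resolvability region -/

theorem theorem2 {X₁ X₂ Z : Type*} [Fintype X₁] [Fintype X₂] [Fintype Z]
    (W : X₁ → X₂ → Z → ℝ) (hW : MACResolvability.IsChannel W)
    (Q : Z → ℝ) (hQ : Q ∈ stdSimplex ℝ Z) :
    MACResolvability.resolvabilityRegion W Q =
      {R : ℝ × ℝ | 0 ≤ R.1 ∧ 0 ≤ R.2 ∧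
        ∃ P ∈ stdSimplex ℝ (X₁ × X₂),
          MACResolvability.lawOutput P W = Q ∧
          MACResolvability.mutualInfo (MACResolvability.lawFirstOutput P W) ≤ R.1 ∧
          MACResolvability.mutualInfo (MACResolvability.lawInputsOutput P W) ≤ R.1 + R.2} := by
  open MACResolvability in
  ext R
  constructor
  · intro hR
    have hclosed : IsClosed {R : ℝ × ℝ | 0 ≤ R.1 ∧ 0 ≤ R.2} :=
      (isClosed_le continuous_const continuous_fst).inter
        (isClosed_le continuous_const continuous_snd)
    have hsub : {R | IsAchievable W Q R} ⊆ {R : ℝ × ℝ | 0 ≤ R.1 ∧ 0 ≤ R.2} :=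
      fun R hR => ⟨hR.1, hR.2.1⟩
    have h0 := closure_minimal hsub hclosed hR
    refine ⟨h0.1, h0.2, exists_law_of_forall_approx hW hQ fun ε hε => ?_⟩
    -- Moving each rate by less than `ε/4` changes their sum by less than `ε/2`, leaving `ε/2` for
    -- the single-letter approximation.
    obtain ⟨R', hR', hd⟩ := Metric.mem_closure_iff.1 hR (ε / 4) (by positivity)
    obtain ⟨P, hP, g₀, g₁, g₂⟩ := IsAchievable.exists_law hW hQ hR' (half_pos hε)
    rw [Prod.dist_eq, max_lt_iff, Real.dist_eq, Real.dist_eq, abs_lt, abs_lt] at hd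
    exact ⟨P, hP, by linarith, by linarith [hd.1.1], by linarith [hd.1.1, hd.2.1]⟩
  · rintro ⟨hR₁, hR₂, P, hP, hPQ, h₁, h₂⟩
    -- Raising both rates by `ε/2` makes the constraints strict and moves the pair by `ε/2` in the
    -- sup distance.
    refine Metric.mem_closure_iff.2 fun ε hε =>
      ⟨(R.1 + ε / 2, R.2 + ε / 2), isAchievable_of_lt hW hQ hP hPQ (by dsimp only; positivity)
        (by dsimp only; positivity) (by dsimp only; linarith) (by dsimp only; linarith), ?_⟩
    rw [Prod.dist_eq, max_lt_iff, Real.dist_eq, Real.dist_eq, abs_lt, abs_lt]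
    exact ⟨⟨by dsimp only; linarith, by dsimp only; linarith⟩,
      ⟨by dsimp only; linarith, by dsimp only; linarith⟩⟩
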